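/- Let $d\in\mathbb N_0$. For $X\subseteq\mathbb R^d$ open let $\mathscr D(X)$ be the space of complex-valued smooth functions with compact support in $X$, with its usual (LF) topology, and let $\mathscr D'(X)$ be its dual, with the strong topology (uniform convergence on bounded subsets of $\mathscr D(X)$). A sheaf $\mathscr G$ of distributions on $\mathbb R^d$ defined by local properties assigns to each open $X\subseteq\mathbb R^d$ a linear subspace $\mathscr G(X)\subseteq\mathscr D'(X)$, equipped with the relative topology, such that (1) for open $Y\subseteq X$ the restriction $r_X^Y:\mathscr G(X)\to\mathscr G(Y)$, $u\mapsto u|_{\mathscr D(Y)}$, is well defined; (2) for every open cover $(X_\iota)_\iota$ of $X$ and all $u_\iota\in\mathscr G(X_\iota)$ with $u_\iota=u_\kappa$ on $X_\iota\cap X_\kappa$ for all $\iota,\kappa$ there is $u\in\mathscr G(X)$ with $u|_{X_\iota}=u_\iota$ for all $\iota$ (uniqueness of $u$ is automatic). Let $X\subseteq\mathbb R^d$ be open, let $w\in C^\infty(X)$ be complex-valued, and let $\psi:X\to X$ be smooth and injective with $\det J\psi(x)\neq0$ for all $x\in X$. Then there is a unique continuous linear operator $C_{w,\psi}$ on $\mathscr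 D'(X)$ with $C_{w,\psi}(f)=w\cdot(f\circ\psi)$ for all $f\in C(X)$, where continuous functions on $X$ are regarded as distributions. Let moreover $\mathscr G$ be a sheaf of distributions on $\mathbb R^d$ defined by local properties with $C_{w,\psi}(\mathscr G(X))\subseteq\mathscr G(X)$, and assume the following conditions. a) There is a sequence $(X_n)_{n\in\mathbb N}$ of open sets with union $X$, such that each $\overline{X_n}$ is compact and contained in $X_{n+1}$, and such that for every $n$, every $x\in X\setminus\overline{X_n}$ and every $\varepsilon>0$ with $\overline{B(x,\varepsilon)}\subseteq X\setminus X_n$ the restriction $r_X^{X_n\cup B(x,\varepsilon)}:\mathscr G(X)\to\mathscr G(X_n\cup B(x,\varepsilon))$ has dense range. b) There is $\varepsilon_0>0$ such that for all $\varepsilon\in(0,\varepsilon_0)$ there is $\chi_\varepsilon\in\mathscr D(B(0,\varepsilon))$ such that for all $x\in X$ with $\overline{B(x,\varepsilon)}\subseteq X$ there is $h\in\mathscr G(B(x,\varepsilon))$ with $\langle h,\chi_\varepsilon(\cdot-x)\rangle\neq0$. c) For every $l\in\mathbb N_0$ the set $\{x\in X:\ w(\psi^l(x))\neq0\}$ is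 dense in $X$. Then the following are equivalent: (i) $C_{w,\psi}$ is topologizable on $\mathscr G(X)$, i.e. for every continuous seminorm $p$ on $\mathscr G(X)$ there is a continuous seminorm $q$ on $\mathscr G(X)$ such that for every $m\in\mathbb N$ there is $\gamma_m>0$ with $p(C_{w,\psi}^m(u))\le\gamma_m\,q(u)$ for all $u\in\mathscr G(X)$; (ii) $\psi$ has stable orbits, i.e. for every compact $K\subseteq X$ there is a compact $L\subseteq X$ with $\psi^m(K)\subseteq L$ for all $m\in\mathbb N$. -/

import Mathlib

open TopologicalSpace
open scoped Distributions ContDiff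

noncomputable section

namespace DistSheaf

/-- The space `ℝ^d` with its Euclidean norm. -/
abbrev Eucl (d : ℕ) : Type := EuclideanSpace ℝ (Fin d)

/-- The space `𝒟'(X)` of complex distributions on `X`: the continuous `ℂ`-linear functionals on
the complex test functions `𝒟(X)` (with the usual LF topology). Mathlib's topology on
`_ →L[ℂ] ℂ` is uniform convergence on bounded sets, i.e. the strong dual topology. -/
abbrev Distr {d : ℕ} (X : Opens (Eucl d)) : Type := 𝓓(X, ℂ) →L[ℂ] ℂ

/-- The open Euclidean ball as an element of `Opens`. -/
def ball {d : ℕ} (x : Eucl d) (ε : ℝ) : Opens (Eucl d) := ⟨Metric.ball x ε, Metric.isOpen_ball⟩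

/-- The restriction `u ↦ u|_Y` to `𝒟(Y)` for `Y ⊆ X` (only used for `Y ⊆ X`). -/
def restrict {d : ℕ} {X : Opens (Eucl d)} (Y : Opens (Eucl d)) (u : Distr X) : Distr Y :=
  u.comp (TestFunction.monoCLM ℂ)

/-- The distribution `φ ↦ ∫ φ f` given by a continuous function `f` on `X`
(only used for such `f`). -/
def ofFun {d : ℕ} (X : Opens (Eucl d)) (f : Eucl d → ℂ) : Distr X :=
  TestFunction.integralAgainstBilinCLM (ContinuousLinearMap.mul ℂ ℂ) MeasureTheory.volume f

/-- The translate `τ_x χ (y) = χ (y - x)` of `χ ∈ 𝒟(B(0,ε))`, an element of `𝒟(B(x,ε))`. -/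
def translate {d : ℕ} (x : Eucl d) {ε : ℝ} (χ : 𝓓(ball (0 : Eucl d) ε, ℂ)) :
    𝓓(ball x ε, ℂ) where
  toFun y := χ (y - x)
  contDiff' := χ.contDiff.comp (contDiff_id.sub contDiff_const)
  hasCompactSupport' := χ.hasCompactSupport.comp_homeomorph (Homeomorph.subRight x)
  tsupport_subset' := by
    intro y hy
    have h : y - x ∈ tsupport χ :=
      tsupport_comp_subset_preimage χ (f := fun y => y - x) (by fun_prop) hy
    have h' : y - x ∈ Metric.ball (0 : Eucl d) ε := χ.tsupport_subset h
    change y ∈ Metric.ball x ε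
    rwa [mem_ball_zero_iff, ← mem_ball_iff_norm] at h'

/-- A sheaf of distributions on `ℝ^d` defined by local properties. The localization (uniqueness)
axiom is not listed since it holds automatically for subspaces of `𝒟'(X)`. Each `G.obj X` carries
the subspace topology of `𝒟'(X)`. -/
structure SheafOfDistributions (d : ℕ) where
  obj : (X : Opens (Eucl d)) → Submodule ℂ (Distr X)
  restrict_mem : ∀ {X Y : Opens (Eucl d)}, Y ≤ X → ∀ u ∈ obj X, restrict Y u ∈ obj Y
  gluing : ∀ (X : Opens (Eucl d)) {ι : Type} (U : ι → Opens (Eucl d)), ⨆ i, U i = X →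
    ∀ u : (i : ι) → Distr (U i), (∀ i, u i ∈ obj (U i)) →
      (∀ i j, restrict (U i ⊓ U j) (u i) = restrict (U i ⊓ U j) (u j)) →
      ∃ v ∈ obj X, ∀ i, restrict (U i) v = u i

/-- The restriction map `r_X^Y : G(X) → G(Y)`. -/
def SheafOfDistributions.res {d : ℕ} (G : SheafOfDistributions d) {X Y : Opens (Eucl d)}
    (h : Y ≤ X) (u : G.obj X) : G.obj Y :=
  ⟨restrict Y u.1, G.restrict_mem h u.1 u.2⟩

/-- `C` is a continuous linear operator on `𝒟'(X)` which extends the weighted composition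
operator `f ↦ w · (f ∘ ψ)` on `C(X)`. -/
def IsWeightedCompositionOperator {d : ℕ} (X : Opens (Eucl d)) (w : Eucl d → ℂ)
    (ψ : Eucl d → Eucl d) (C : Distr X →L[ℂ] Distr X) : Prop :=
  ∀ f : Eucl d → ℂ, ContinuousOn f X → C (ofFun X f) = ofFun X (fun x => w x * f (ψ x))

/-- Topologizable operators on a locally convex space. -/
def IsTopologizable {E : Type*} [AddCommGroup E] [Module ℂ E] [TopologicalSpace E]
    (T : E →L[ℂ] E) : Prop :=
  ∀ p : Seminorm ℂ E, Continuous p → ∃ q : Seminorm ℂ E, Continuous q ∧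
    ∀ m : ℕ, 1 ≤ m → ∃ γ : ℝ, 0 < γ ∧ ∀ x : E, p ((T ^ m) x) ≤ γ * q x

/-- The self-map `ψ` of `X` has stable orbits. -/
def HasStableOrbits {d : ℕ} (X : Opens (Eucl d)) (ψ : Eucl d → Eucl d) : Prop :=
  ∀ K : Set (Eucl d), IsCompact K → K ⊆ X →
    ∃ L : Set (Eucl d), IsCompact L ∧ L ⊆ X ∧ ∀ m : ℕ, 1 ≤ m → ψ^[m] '' K ⊆ L

/-- `(X_n)` is an open, relatively compact exhaustion of `X`. -/
structure IsExhaustion {d : ℕ} (X : Opens (Eucl d)) (Xn : ℕ → Opens (Eucl d)) : Prop where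
  isCompact_closure : ∀ n, IsCompact (closure (Xn n : Set (Eucl d)))
  closure_subset : ∀ n, closure (Xn n : Set (Eucl d)) ⊆ Xn (n + 1)
  iSup_eq : ⨆ n, Xn n = X

/-- Condition a): density of the ranges of certain restrictions. -/
def ConditionA {d : ℕ} (G : SheafOfDistributions d) (X : Opens (Eucl d)) : Prop :=
  ∃ Xn : ℕ → Opens (Eucl d), IsExhaustion X Xn ∧
    ∀ n : ℕ, ∀ x ∈ (X : Set (Eucl d)) \ closure (Xn n : Set (Eucl d)), ∀ ε : ℝ, 0 < ε →
      closure (Metric.ball x ε) ⊆ (X : Set (Eucl d)) \ (Xn n : Set (Eucl d)) →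
        ∀ h : Xn n ⊔ ball x ε ≤ X, DenseRange (G.res h)

/-- Condition b): nondegenerate local elements. -/
def ConditionB {d : ℕ} (G : SheafOfDistributions d) (X : Opens (Eucl d)) : Prop :=
  ∃ ε₀ : ℝ, 0 < ε₀ ∧ ∀ ε : ℝ, 0 < ε → ε < ε₀ →
    ∃ χ : 𝓓(ball (0 : Eucl d) ε, ℂ), ∀ x ∈ X, closure (Metric.ball x ε) ⊆ X →
      ∃ h ∈ G.obj (ball x ε), h (translate x χ) ≠ 0

/-- Condition c): each `w ∘ ψ^l` is nonzero on a dense subset of `X`. -/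
def ConditionC {d : ℕ} (X : Opens (Eucl d)) (w : Eucl d → ℂ) (ψ : Eucl d → Eucl d) : Prop :=
  ∀ l : ℕ, (X : Set (Eucl d)) ⊆ closure {x | x ∈ X ∧ w (ψ^[l] x) ≠ 0}

/-- The restriction of an operator on `𝒟'(X)` to an invariant subspace. -/
def restrictOp {d : ℕ} {X : Opens (Eucl d)} (C : Distr X →L[ℂ] Distr X)
    (V : Submodule ℂ (Distr X)) (h : ∀ u ∈ V, C u ∈ V) : V →L[ℂ] V :=
  (C.comp V.subtypeL).codRestrict V (fun u => h u.1 u.2)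

end DistSheaf

end

noncomputable section

namespace DistSheaf

section

open Set Filter Bornology Topology
open scoped BoundedContinuousFunction

variable {d : ℕ}

/-! ### Bounded sets of test functions -/

/-! The operator is the transpose of a continuous operator `T` on `𝒟(X)`: by change of variables, `T
φ` is `(w / |det Jψ| · φ) ∘ ψ⁻¹` on the open set `ψ(X)` and zero elsewhere (`exists_transpose`).
Uniqueness follows from the density of continuous functions in the strong topology of `𝒟'(X)`
(`exists_continuous_approx`).

A continuous seminorm on a subspace of `𝒟'(X)` is dominated by a multiple of a supremum over a
bounded set `B` of test functions, and `B` is a bounded subset of a single step `𝓓_K`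
(`exists_isVonNBounded_supportedIn`). Applying the operator `m` times replaces `B` by `T^m(B)`,
whose members have support in `ψ^m(K)`. With stable orbits, all these sets for `m ≥ 1` lie in one
`𝓓_L`; countably many bounded sets there can be rescaled so that their union is bounded
(`exists_isVonNBounded_iUnion_smul`), and the supremum over that union serves as `q`.

Conversely, suppose the orbits of some compact set leave every compact set. For each `n`, conditions
b) and c) give an iterate `m`, a closed ball off `closure X_n`, and a test function `χ` on the open
ball that some element of `G` detects and that equals `T^m φ_n`, with all `φ_n` in one `𝓓_K`
(`IsTranspose.exists_escaping_testFunction`). Rescaled, the `φ_n` form a bounded set, which defines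
`p`. A seminorm `q` only sees test functions supported in some `X_n`. Gluing gives an element of `G`
on `X_n ∪ ball` that is zero on `X_n` but not on `χ`; by a) it is a limit of restrictions of
elements of `G(X)`, which violates the inequality for the iterate `m` chosen for this `n`
(`exists_not_le_of_denseRange`). -/

theorem exists_compact_exhaustion (X : Opens (Eucl d)) :
    ∃ K : ℕ → Compacts (Eucl d), Monotone K ∧ (∀ n, (K n : Set (Eucl d)) ⊆ X) ∧
      ∀ L : Set (Eucl d), IsCompact L → L ⊆ X → ∃ n, L ⊆ K n := by
  have : LocallyCompactSpace X := X.isOpen.locallyCompactSpace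
  let c : CompactExhaustion X := default
  refine ⟨fun n => ⟨Subtype.val '' c n, (c.isCompact n).image continuous_subtype_val⟩,
    fun m n h => image_mono (c.subset h), fun n => Subtype.coe_image_subset _ _, ?_⟩
  intro L hL hLX
  have hL' : IsCompact (Subtype.val ⁻¹' L : Set X) :=
    Topology.IsInducing.subtypeVal.isCompact_preimage_iff (by simpa using hLX) |>.2 hL
  obtain ⟨n, hn⟩ := c.exists_superset_of_isCompact hL'
  refine ⟨n, fun x hx => ⟨⟨x, hLX hx⟩, hn hx, rfl⟩⟩

/-- Weighted evaluation of test functions along a sequence that eventually leaves every compact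
subset of `X`, with values in the bounded sequences. -/
theorem exists_weightedEval (X : Opens (Eucl d)) (x : ℕ → Eucl d) (a : ℕ → ℂ)
    (hx : ∀ L : Set (Eucl d), IsCompact L → L ⊆ X → ∃ N, ∀ n, x n ∈ L → n < N) :
    ∃ S : 𝓓(X, ℂ) →L[ℂ] (ℕ →ᵇ ℂ), ∀ φ n, S φ n = a n * φ (x n) := by
  have bd (φ : 𝓓(X, ℂ)) : ∃ C, ∀ n, ‖a n * φ (x n)‖ ≤ C := by
    obtain ⟨N, hN⟩ := hx _ φ.hasCompactSupport φ.tsupport_subset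
    refine ⟨∑ n ∈ Finset.range N, ‖a n * φ (x n)‖, fun n => ?_⟩
    by_cases h : x n ∈ tsupport φ
    · exact Finset.single_le_sum (f := fun n => ‖a n * φ (x n)‖) (fun _ _ => norm_nonneg _)
        (Finset.mem_range.2 (hN n h))
    · simpa [image_eq_zero_of_notMem_tsupport h] using
        Finset.sum_nonneg fun _ _ => mul_nonneg (norm_nonneg _) (norm_nonneg _)
  let F (φ : 𝓓(X, ℂ)) : ℕ →ᵇ ℂ := BoundedContinuousFunction.ofNormedAddCommGroupDiscrete
    (fun n => a n * φ (x n)) (bd φ).choose (bd φ).choose_spec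
  have hF (φ n) : F φ n = a n * φ (x n) := rfl
  have hadd (f g) : F (f + g) = F f + F g := by
    ext n; simp [hF, mul_add]
  have hsmul (c : ℂ) (f) : F (c • f) = c • F f := by
    ext n; simp [hF]; ring
  refine ⟨TestFunction.mkCLM ℂ F hadd hsmul fun K hK => ?_, fun φ n => hF φ n⟩
  obtain ⟨N, hN⟩ := hx _ K.isCompact hK
  refine (ContDiffMapSupportedIn.mkCLMtoNormedSpace ℂ
    (F ∘ TestFunction.ofSupportedIn hK) (fun f g => hadd (.ofSupportedIn hK f) (.ofSupportedIn hK g))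
    (fun c f => hsmul c (.ofSupportedIn hK f))
    ⟨{0}, ∑ n ∈ Finset.range N, ‖a n‖, by positivity, fun f => ?_⟩).continuous
  rw [BoundedContinuousFunction.norm_le (by positivity)]
  intro n
  simp only [Function.comp, hF, Finset.sup_singleton, norm_mul]
  by_cases h : x n ∈ K
  · gcongr
    · exact Finset.single_le_sum (f := fun n => ‖a n‖) (fun _ _ => norm_nonneg _)
        (Finset.mem_range.2 (hN n h))
    · exact ContDiffMapSupportedIn.norm_apply_le_seminorm ℂ
  · have : (TestFunction.ofSupportedIn hK f) (x n) = 0 := f.zero_on_compl h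
    rw [this]
    simp only [norm_zero, mul_zero]
    positivity

/-- Gliding hump: otherwise there are `φ n ∈ B` and `x n ∉ K n` with `φ n (x n) ≠ 0`. Evaluation at
the points `x n` with weights `n / φ n (x n)` is continuous, because each compact set meets only
finitely many of the points, yet it sends `φ n` to a sequence of norm at least `n`. -/
theorem exists_common_support {X : Opens (Eucl d)} {B : Set 𝓓(X, ℂ)} (hB : IsVonNBounded ℂ B) :
    ∃ K : Compacts (Eucl d), (K : Set (Eucl d)) ⊆ X ∧ ∀ φ ∈ B, Function.support φ ⊆ K := by
  obtain ⟨K, hKmono, hKX, hK⟩ := exists_compact_exhaustion X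
  by_contra! hcon
  have H (n : ℕ) : ∃ φ ∈ B, ∃ x, φ x ≠ 0 ∧ x ∉ K n := by
    obtain ⟨φ, hφ, h⟩ := hcon (K n) (hKX n)
    obtain ⟨x, hx, hx'⟩ := not_subset.1 h
    exact ⟨φ, hφ, x, hx, hx'⟩
  choose φ hφB x hφx hxK using H
  obtain ⟨S, hS⟩ := exists_weightedEval X x (fun n => n * (φ n (x n))⁻¹) (fun L hL hLX => by
    obtain ⟨N, hN⟩ := hK L hL hLX
    refine ⟨N, fun n hn => ?_⟩
    by_contra! h
    exact hxK n (hKmono h (hN hn)))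
  obtain ⟨r, hr⟩ := (NormedSpace.isVonNBounded_iff' ℂ).1 (hB.image S)
  obtain ⟨n, hn⟩ := exists_nat_gt r
  have h1 := hr _ (mem_image_of_mem S (hφB n))
  have h2 := (S (φ n)).norm_coe_le_norm n
  rw [hS, inv_mul_cancel_right₀ (hφx n)] at h2
  simp at h2
  linarith

/-- A linear operator from test functions to continuous functions that is controlled by the `i`-th
derivative is uniformly bounded on bounded sets. -/
theorem exists_norm_bound_of_le_seminorm {W : Type*} [NormedAddCommGroup W] [NormedSpace ℂ W]
    {X : Opens (Eucl d)} (D : 𝓓(X, ℂ) → Eucl d → W)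
    (hadd : ∀ φ θ x, D (φ + θ) x = D φ x + D θ x) (hsmul : ∀ (c : ℂ) φ x, D (c • φ) x = c • D φ x)
    (hcont : ∀ φ, Continuous (D φ)) (i : ℕ)
    (hD : ∀ (K : Compacts (Eucl d)) (hK : (K : Set (Eucl d)) ⊆ X) (f : 𝓓_{K}(Eucl d, ℂ)) x,
      ‖D (TestFunction.ofSupportedIn hK f) x‖ ≤ N[ℂ]_{K, i} f)
    {B : Set 𝓓(X, ℂ)} (hB : IsVonNBounded ℂ B) : ∃ r, ∀ φ ∈ B, ∀ x, ‖D φ x‖ ≤ r := by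
  have bd (φ : 𝓓(X, ℂ)) : ∃ C, ∀ x, ‖D φ x‖ ≤ C :=
    ⟨_, hD ⟨tsupport φ, φ.hasCompactSupport⟩ φ.tsupport_subset
      (.of_support_subset φ.contDiff subset_closure)⟩
  let F (φ : 𝓓(X, ℂ)) : Eucl d →ᵇ W := BoundedContinuousFunction.ofNormedAddCommGroup (D φ)
    (hcont φ) (bd φ).choose (bd φ).choose_spec
  have hFadd (φ θ) : F (φ + θ) = F φ + F θ := by ext1 x; exact hadd φ θ x
  have hFsmul (c : ℂ) (φ) : F (c • φ) = c • F φ := by ext1 x; exact hsmul c φ x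
  let S : 𝓓(X, ℂ) →L[ℂ] (Eucl d →ᵇ W) := TestFunction.mkCLM ℂ F hFadd hFsmul fun K hK =>
    (ContDiffMapSupportedIn.mkCLMtoNormedSpace ℂ (F ∘ TestFunction.ofSupportedIn hK)
      (fun f g => hFadd (.ofSupportedIn hK f) (.ofSupportedIn hK g))
      (fun c f => hFsmul c (.ofSupportedIn hK f))
      ⟨{i}, 1, zero_le_one, fun f => by
        rw [Finset.sup_singleton, one_mul, BoundedContinuousFunction.norm_le (apply_nonneg _ _)]
        exact hD K hK f⟩).continuous
  obtain ⟨r, hr⟩ := (NormedSpace.isVonNBounded_iff' ℂ).1 (hB.image S)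
  exact ⟨r, fun φ hφ x => ((S φ).norm_coe_le_norm x).trans (hr _ (mem_image_of_mem S hφ))⟩

theorem exists_iteratedFDeriv_bound {X : Opens (Eucl d)} {B : Set 𝓓(X, ℂ)}
    (hB : IsVonNBounded ℂ B) (i : ℕ) : ∃ r, ∀ φ ∈ B, ∀ x, ‖iteratedFDeriv ℝ i φ x‖ ≤ r := by
  have hi : (i : ℕ∞ω) ≤ ((⊤ : ℕ∞) : ℕ∞ω) := mod_cast le_top
  refine exists_norm_bound_of_le_seminorm (W := Eucl d [×i]→L[ℝ] ℂ)
    (fun φ => iteratedFDeriv ℝ i φ) (fun φ θ x => ?_) (fun c φ x => ?_)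
    (fun φ => φ.contDiff.continuous_iteratedFDeriv hi) i (fun K hK f x => ?_) hB
  · exact congrFun (iteratedFDeriv_add (φ.contDiff.of_le hi) (θ.contDiff.of_le hi)) x
  · exact iteratedFDeriv_const_smul_apply (φ.contDiff.of_le hi).contDiffAt
  · exact ContDiffMapSupportedIn.norm_iteratedFDeriv_apply_le_seminorm_top ℂ

/-- Boundedness in `𝓓_K` is tested by sup norms of derivatives, and these are already bounded on
`B`. No embedding property of `𝓓_K` into `𝒟(X)` is needed. -/
theorem isVonNBounded_preimage_ofSupportedIn {X : Opens (Eucl d)} {K : Compacts (Eucl d)}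
    (hK : (K : Set (Eucl d)) ⊆ X) {B : Set 𝓓(X, ℂ)} (hB : IsVonNBounded ℂ B) :
    IsVonNBounded ℂ (TestFunction.ofSupportedIn hK ⁻¹' B : Set 𝓓_{K}(Eucl d, ℂ)) := by
  rw [(ContDiffMapSupportedIn.withSeminorms ℂ _ _ _ _).isVonNBounded_iff_seminorm_bounded]
  intro i
  obtain ⟨r, hr⟩ := exists_iteratedFDeriv_bound hB i
  refine ⟨max r 0 + 1, by positivity, fun f hf => lt_of_le_of_lt ?_ (lt_add_one _)⟩
  rw [ContDiffMapSupportedIn.seminorm_top_le_iff ℂ (le_max_right _ _)]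
  exact fun x _ => (hr _ hf x).trans (le_max_left _ _)

/-- A bounded set of test functions is a bounded subset of some step `𝓓_K`. -/
theorem exists_isVonNBounded_supportedIn {X : Opens (Eucl d)} {B : Set 𝓓(X, ℂ)}
    (hB : IsVonNBounded ℂ B) :
    ∃ (K : Compacts (Eucl d)) (hK : (K : Set (Eucl d)) ⊆ X) (A : Set 𝓓_{K}(Eucl d, ℂ)),
      IsVonNBounded ℂ A ∧ TestFunction.ofSupportedIn hK '' A = B := by
  obtain ⟨K, hKX, hK⟩ := exists_common_support hB
  refine ⟨K, hKX, TestFunction.ofSupportedIn hKX ⁻¹' B,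
    isVonNBounded_preimage_ofSupportedIn hKX hB, image_preimage_eq_of_subset fun φ hφ => ?_⟩
  exact ⟨.of_support_subset φ.contDiff (hK φ hφ), rfl⟩

theorem isVonNBounded_image_ofSupportedIn {X : Opens (Eucl d)} {K : Compacts (Eucl d)}
    (hK : (K : Set (Eucl d)) ⊆ X) {A : Set 𝓓_{K}(Eucl d, ℂ)} (hA : IsVonNBounded ℂ A) :
    IsVonNBounded ℂ (TestFunction.ofSupportedIn hK '' A : Set 𝓓(X, ℂ)) :=
  hA.image (TestFunction.ofSupportedInCLM ℂ hK)

/-- Mackey's countability condition in the step `𝓓_K`. -/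
theorem exists_isVonNBounded_iUnion_smul {K : Compacts (Eucl d)} (A : ℕ → Set 𝓓_{K}(Eucl d, ℂ))
    (hA : ∀ m, IsVonNBounded ℂ (A m)) :
    ∃ c : ℕ → ℝ, (∀ m, 0 < c m) ∧ IsVonNBounded ℂ (⋃ m, (fun f => (c m : ℂ) • f) '' A m) := by
  have hs := ContDiffMapSupportedIn.withSeminorms ℂ (Eucl d) ℂ ⊤ K
  simp_rw [hs.isVonNBounded_iff_seminorm_bounded] at hA ⊢
  choose r hr hrA using hA
  -- With this scaling the `i`-th seminorm on the `m`-th set is at most 1 as soon as `i ≤ m`. Only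
  -- the finitely many `m < i` remain, and the bound below sums their contributions.
  refine ⟨fun m => (∑ i ∈ Finset.range (m + 1), r m i)⁻¹,
    fun m => inv_pos.2 (Finset.sum_pos (fun i _ => hr m i) (by simp)), fun i => ?_⟩
  have hpos (m : ℕ) : 0 < ∑ i ∈ Finset.range (m + 1), r m i :=
    Finset.sum_pos (fun i _ => hr m i) (by simp)
  refine ⟨1 + ∑ m ∈ Finset.range i, (∑ j ∈ Finset.range (m + 1), r m j)⁻¹ * r m i,
    add_pos_of_pos_of_nonneg one_pos (Finset.sum_nonneg fun m _ =>
      (mul_pos (inv_pos.2 (hpos m)) (hr m i)).le), ?_⟩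
  simp only [mem_iUnion, mem_image]
  rintro _ ⟨m, f, hf, rfl⟩
  rw [map_smul_eq_mul, Complex.norm_real, Real.norm_of_nonneg (inv_pos.2 (hpos m)).le]
  refine (mul_lt_mul_of_pos_left (hrA m i f hf) (inv_pos.2 (hpos m))).trans_le ?_
  have hnn (m : ℕ) : 0 ≤ (∑ j ∈ Finset.range (m + 1), r m j)⁻¹ * r m i :=
    (mul_pos (inv_pos.2 (hpos m)) (hr m i)).le
  rcases lt_or_ge m i with h | h
  · have := Finset.single_le_sum (f := fun m => (∑ j ∈ Finset.range (m + 1), r m j)⁻¹ * r m i)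
      (fun m _ => hnn m) (Finset.mem_range.2 h)
    linarith
  · have h1 : r m i ≤ ∑ j ∈ Finset.range (m + 1), r m j :=
      Finset.single_le_sum (f := r m) (fun j _ => (hr m j).le)
        (Finset.mem_range.2 (Nat.lt_succ_of_le h))
    have h2 : (∑ j ∈ Finset.range (m + 1), r m j)⁻¹ * r m i ≤ 1 :=
      inv_mul_le_one_of_le₀ h1 (hpos m).le
    have := Finset.sum_nonneg (s := Finset.range i) fun m _ => hnn m
    linarith

/-! ### Seminorms on spaces of distributions -/

/-- Every continuous seminorm on a subspace of `𝒟'(X)` is dominated by the supremum over a bounded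
set of test functions. -/
theorem exists_bounded_of_continuous_seminorm {X : Opens (Eucl d)} {V : Submodule ℂ (Distr X)}
    (p : Seminorm ℂ V) (hp : Continuous p) :
    ∃ B : Set 𝓓(X, ℂ), IsVonNBounded ℂ B ∧ ∃ c : ℝ, 0 < c ∧
      ∀ (u : V) (r : ℝ), 0 ≤ r → (∀ φ ∈ B, ‖u.1 φ‖ ≤ r) → p u ≤ c * r := by
  have h0 : {u : V | p u < 1} ∈ 𝓝 (0 : V) :=
    (isOpen_Iio.preimage hp).mem_nhds (by simp)
  rw [nhds_subtype, mem_comap] at h0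
  obtain ⟨t, ht, htp⟩ := h0
  obtain ⟨⟨B, ε⟩, ⟨hB, hε⟩, hBt⟩ := (ContinuousLinearMap.hasBasis_nhds_zero_of_basis
    (E := 𝓓(X, ℂ)) (σ := RingHom.id ℂ) (Metric.nhds_basis_closedBall (x := (0 : ℂ)))).mem_iff.1 ht
  refine ⟨B, hB, ε⁻¹, inv_pos.2 hε, fun u r hr hu => ?_⟩
  -- Passing to `s > r` keeps the scaling factor `ε / s` meaningful when `r = 0`; letting `s`
  -- decrease to `r` recovers the claim.
  have key (s : ℝ) (hs : r < s) : p u ≤ ε⁻¹ * s := by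
    have hs0 : 0 < s := hr.trans_lt hs
    have hmem : (((ε / s : ℝ) : ℂ) • u : V) ∈ {u : V | p u < 1} := by
      refine htp (hBt fun φ hφ => ?_)
      simp only [mem_closedBall_zero_iff, Submodule.coe_smul, smul_apply,
        norm_smul, Complex.norm_real, Real.norm_of_nonneg (div_pos hε hs0).le]
      calc ε / s * ‖u.1 φ‖ ≤ ε / s * s := by gcongr; exact (hu φ hφ).trans hs.le
        _ = ε := div_mul_cancel₀ _ hs0.ne'
    rw [mem_ofPred_eq, map_smul_eq_mul, Complex.norm_real, Real.norm_of_nonneg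
      (div_pos hε hs0).le, div_mul_eq_mul_div, div_lt_one hs0] at hmem
    rw [inv_mul_eq_div, le_div_iff₀ hε]
    linarith
  refine le_of_forall_gt_imp_ge_of_dense fun b hb => ?_
  have := key (ε * b) ((inv_mul_lt_iff₀ hε).1 hb)
  rwa [inv_mul_cancel_left₀ hε.ne'] at this

theorem bddAbove_norm_apply {X : Opens (Eucl d)} {B : Set 𝓓(X, ℂ)} (hB : IsVonNBounded ℂ B)
    (u : Distr X) : BddAbove (range fun φ : B => ‖u φ‖) := by
  obtain ⟨r, hr⟩ := (NormedSpace.isVonNBounded_iff' ℂ).1 (hB.image u)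
  exact ⟨r, by rintro _ ⟨φ, rfl⟩; exact hr _ (mem_image_of_mem u φ.2)⟩

/-- The seminorm `u ↦ sup_{φ ∈ B} |u φ|` on `𝒟'(X)`. -/
def supSeminorm {X : Opens (Eucl d)} {B : Set 𝓓(X, ℂ)} (hB : IsVonNBounded ℂ B) :
    Seminorm ℂ (Distr X) :=
  Seminorm.of (fun u => ⨆ φ : B, ‖u φ‖)
    (fun u v => by
      refine Real.iSup_le (fun φ => ?_) (add_nonneg (Real.iSup_nonneg fun _ => norm_nonneg _)
        (Real.iSup_nonneg fun _ => norm_nonneg _))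
      exact (norm_add_le _ _).trans (add_le_add (le_ciSup (bddAbove_norm_apply hB u) φ)
        (le_ciSup (bddAbove_norm_apply hB v) φ)))
    (fun c u => by
      simp only [smul_apply, norm_smul]
      exact (Real.mul_iSup_of_nonneg (norm_nonneg c) _).symm)

theorem le_supSeminorm {X : Opens (Eucl d)} {B : Set 𝓓(X, ℂ)} (hB : IsVonNBounded ℂ B)
    (u : Distr X) {φ : 𝓓(X, ℂ)} (hφ : φ ∈ B) : ‖u φ‖ ≤ supSeminorm hB u :=
  le_ciSup (bddAbove_norm_apply hB u) ⟨φ, hφ⟩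

theorem supSeminorm_le {X : Opens (Eucl d)} {B : Set 𝓓(X, ℂ)} (hB : IsVonNBounded ℂ B)
    (u : Distr X) {r : ℝ} (hr : 0 ≤ r) (h : ∀ φ ∈ B, ‖u φ‖ ≤ r) : supSeminorm hB u ≤ r :=
  Real.iSup_le (fun φ => h φ φ.2) hr

theorem continuous_supSeminorm {X : Opens (Eucl d)} {B : Set 𝓓(X, ℂ)} (hB : IsVonNBounded ℂ B) :
    Continuous (supSeminorm hB) := by
  -- The radius is 2 because the basic neighbourhood only gives the non-strict bound 1.
  refine Seminorm.continuous (r := 2) ?_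
  refine mem_of_superset ((ContinuousLinearMap.hasBasis_nhds_zero_of_basis
    (E := 𝓓(X, ℂ)) (σ := RingHom.id ℂ) (Metric.nhds_basis_closedBall (x := (0 : ℂ)))).mem_of_mem
    (i := (B, 1)) ⟨hB, one_pos⟩) fun u hu => ?_
  rw [Seminorm.mem_ball_zero]
  refine (supSeminorm_le hB u zero_le_one fun φ hφ => ?_).trans_lt one_lt_two
  simpa using hu φ hφ

end

section

open Set Filter Bornology Topology MeasureTheory
open scoped BoundedContinuousFunction Convolution

variable {d : ℕ}

/-! ### Density of continuous functions in the space of distributions -/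

theorem hasFDerivAt_integral_smul_comp_sub {W : Type*} [NormedAddCommGroup W] [NormedSpace ℝ W]
    [NormedSpace ℂ W] [IsScalarTower ℝ ℂ W] {h : Eucl d → ℂ} (hh : Continuous h)
    {g : Eucl d → W} (hg : ContDiff ℝ ∞ g) (hgs : HasCompactSupport g) (x : Eucl d) :
    HasFDerivAt (fun x => ∫ y, h y • g (x - y)) (∫ y, h y • fderiv ℝ g (x - y)) x := by
  have := hgs.hasFDerivAt_convolution_right (μ := volume) (ContinuousLinearMap.lsmul ℝ ℂ)
    hh.locallyIntegrable (hg.of_le (mod_cast le_top)) x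
  exact this

theorem contDiff_integral_smul_comp_sub {h : Eucl d → ℂ} (hh : Continuous h)
    {g : Eucl d → ℂ} (hg : ContDiff ℝ ∞ g) (hgs : HasCompactSupport g) :
    ContDiff ℝ ∞ (fun x => ∫ y, h y • g (x - y)) :=
  hgs.contDiff_convolution_right (n := ⊤) (μ := volume) (ContinuousLinearMap.lsmul ℝ ℂ)
    hh.locallyIntegrable hg

theorem integrable_smul_comp_sub {V : Type*} [NormedAddCommGroup V] [NormedSpace ℂ V]
    {h : Eucl d → ℂ} (hh : Continuous h) {g : Eucl d → V} (hg : Continuous g)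
    (hgs : HasCompactSupport g) (x : Eucl d) : Integrable fun y => h y • g (x - y) :=
  (hh.smul (hg.comp (continuous_const.sub continuous_id))).integrable_of_hasCompactSupport
    (hgs.comp_homeomorph (Homeomorph.subLeft x)).smul_left

/-- The target `W` is quantified after `i` because the induction replaces `g` by `fderiv ℝ g`, whose
values lie in another space. -/
theorem iteratedFDeriv_integral_smul_comp_sub_apply {h : Eucl d → ℂ} (hh : Continuous h) (i : ℕ) :
    ∀ {W : Type} [NormedAddCommGroup W] [NormedSpace ℝ W] [NormedSpace ℂ W]
      [IsScalarTower ℝ ℂ W] {g : Eucl d → W} (_ : ContDiff ℝ ∞ g) (_ : HasCompactSupport g)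
      (x : Eucl d) (m : Fin i → Eucl d),
        iteratedFDeriv ℝ i (fun x => ∫ y, h y • g (x - y)) x m =
          ∫ y, h y • iteratedFDeriv ℝ i g (x - y) m := by
  induction i with
  | zero => simp
  | succ i ih =>
    intro W _ _ _ _ g hg hgs x m
    have hg' : ContDiff ℝ ∞ (fderiv ℝ g) := hg.fderiv_right (mod_cast le_top)
    have h1 : (fun x => fderiv ℝ (fun x => ∫ y, h y • g (x - y)) x) =
        fun x => ∫ y, h y • fderiv ℝ g (x - y) :=
      funext fun x => (hasFDerivAt_integral_smul_comp_sub hh hg hgs x).fderiv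
    simp only [iteratedFDeriv_succ_apply_right]
    rw [h1, ih hg' (hgs.fderiv ℝ), ContinuousLinearMap.integral_apply]
    · rfl
    · refine integrable_smul_comp_sub hh
        (g := fun z => iteratedFDeriv ℝ i (fderiv ℝ g) z (Fin.init m)) ?_ ?_ x
      · have := hg'.continuous_iteratedFDeriv (m := i) (mod_cast le_top)
        fun_prop
      · refine HasCompactSupport.intro (hgs.fderiv ℝ) fun z hz => ?_
        rw [Function.notMem_support.1 (fun h => hz (support_iteratedFDeriv_subset i h))]
        rfl

theorem iteratedFDeriv_integral_smul_comp_sub {h : Eucl d → ℂ} (hh : Continuous h) (i : ℕ)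
    {g : Eucl d → ℂ} (hg : ContDiff ℝ ∞ g) (hgs : HasCompactSupport g) (x : Eucl d) :
    iteratedFDeriv ℝ i (fun x => ∫ y, h y • g (x - y)) x =
      ∫ y, h y • iteratedFDeriv ℝ i g (x - y) := by
  ext m
  rw [iteratedFDeriv_integral_smul_comp_sub_apply hh i hg hgs, ContinuousMultilinearMap.integral_apply]
  · rfl
  · exact integrable_smul_comp_sub hh (hg.continuous_iteratedFDeriv (mod_cast le_top))
      (hgs.iteratedFDeriv i) x

/-- The bound `hu` makes `u` factor through `φ ↦ D φ` in the bounded continuous functions, and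
Hahn–Banach extends it to a functional `g` on all of them. The density is `f y = g (G (· - y))`:
translates of `G` depend continuously on `y` in sup norm, so `g` may be taken under the integral.
The extension matters because these translates need not come from `M`. -/
theorem exists_continuous_density {W : Type*} [NormedAddCommGroup W] [NormedSpace ℂ W]
    [CompleteSpace W] {M : Type*} [AddCommGroup M] [Module ℂ M] (D : M →ₗ[ℂ] (Eucl d → W))
    (hDc : ∀ φ, Continuous (D φ)) (hDb : ∀ φ, ∃ C, ∀ x, ‖D φ x‖ ≤ C) (u : M →ₗ[ℂ] ℂ) (c : NNReal)
    (hu : ∀ φ r, (∀ x, ‖D φ x‖ ≤ r) → ‖u φ‖ ≤ c * r) {G : Eucl d → W} (hG : Continuous G)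
    (hGs : HasCompactSupport G) :
    ∃ f : Eucl d → ℂ, Continuous f ∧ ∀ h : Eucl d → ℂ, Continuous h → HasCompactSupport h →
      ∀ φ, (∀ x, D φ x = ∫ y, h y • G (x - y)) → u φ = ∫ y, h y * f y := by
  let J : M →ₗ[ℂ] (Eucl d →ᵇ W) :=
    { toFun φ := .ofNormedAddCommGroup (D φ) (hDc φ) (hDb φ).choose (hDb φ).choose_spec
      map_add' φ θ := by ext1 x; exact congrFun (D.map_add φ θ) x
      map_smul' a φ := by ext1 x; exact congrFun (D.map_smul a φ) x }
  have hJ (φ x) : J φ x = D φ x := rfl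
  have huJ (φ) : ‖u φ‖ ≤ c * ‖J φ‖ := hu φ _ fun x => (J φ).norm_coe_le_norm x
  have hker : LinearMap.ker J ≤ LinearMap.ker u := fun φ hφ => by
    have := huJ φ
    rw [LinearMap.mem_ker.1 hφ, norm_zero, mul_zero] at this
    exact norm_le_zero_iff.1 this
  let v : Module.Dual ℂ (LinearMap.range J) :=
    (LinearMap.ker J).liftQ u hker ∘ₗ J.quotKerEquivRange.symm.toLinearMap
  have hv (φ) : v ⟨J φ, LinearMap.mem_range_self J φ⟩ = u φ := by
    change (LinearMap.ker J).liftQ u hker (J.quotKerEquivRange.symm _) = _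
    rw [show (⟨J φ, LinearMap.mem_range_self J φ⟩ : LinearMap.range J) =
      J.quotKerEquivRange (Submodule.Quotient.mk φ) from rfl, LinearEquiv.symm_apply_apply,
      Submodule.liftQ_apply]
  obtain ⟨g, hg, -⟩ := Module.Dual.exists_continuous_extension_of_le_seminorm (LinearMap.range J) v
    (p := c • normSeminorm ℂ _) (continuous_norm.const_smul c) (by
      rintro ⟨_, φ, rfl⟩
      exact (hv φ).symm ▸ huJ φ)
  obtain ⟨CG, hCG⟩ := hG.bounded_above_of_compact_support hGs
  let Γ (y : Eucl d) : Eucl d →ᵇ W := .ofNormedAddCommGroup (fun x => G (x - y))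
    (hG.comp (continuous_id.sub continuous_const)) CG (fun x => hCG _)
  have hΓ (y x) : Γ y x = G (x - y) := rfl
  have hΓc : Continuous Γ := by
    have huc := hG.uniformContinuous_of_tendsto_cocompact hGs.is_zero_at_infty
    rw [Metric.uniformContinuous_iff] at huc
    rw [Metric.continuous_iff]
    intro b ε hε
    obtain ⟨δ, hδ, H⟩ := huc (ε / 2) (half_pos hε)
    refine ⟨δ, hδ, fun a hab => lt_of_le_of_lt ?_ (half_lt_self hε)⟩
    refine (BoundedContinuousFunction.dist_le (half_pos hε).le).2 fun x => (H ?_).le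
    rwa [dist_sub_left]
  refine ⟨fun y => g (Γ y), g.continuous.comp hΓc, fun h hh hhs φ hφ => ?_⟩
  have hint : Integrable (fun y => h y • Γ y) :=
    (hh.smul hΓc).integrable_of_hasCompactSupport hhs.smul_right
  have key : J φ = ∫ y, h y • Γ y := by
    ext1 x
    rw [hJ, hφ]
    exact (BoundedContinuousFunction.evalCLM ℂ x).integral_comp_comm hint
  rw [← hv, ← hg]
  simp only
  rw [key, ← g.integral_comp_comm hint]
  simp

theorem norm_iteratedFDeriv_sub_le {φ : Eucl d → ℂ} (hφ : ContDiff ℝ ∞ φ) {i : ℕ} {r : ℝ}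
    (hr : ∀ x, ‖iteratedFDeriv ℝ (i + 1) φ x‖ ≤ r) (x y : Eucl d) :
    ‖iteratedFDeriv ℝ i φ (x - y) - iteratedFDeriv ℝ i φ x‖ ≤ r * ‖y‖ := by
  have := Convex.norm_image_sub_le_of_norm_fderiv_le (𝕜 := ℝ) (f := iteratedFDeriv ℝ i φ) (C := r)
    (s := univ) (x := x) (y := x - y) (fun z _ => (hφ.differentiable_iteratedFDeriv
      (by exact_mod_cast ENat.natCast_lt_top i)) z)
    (fun z _ => by rw [norm_fderiv_iteratedFDeriv]; exact hr z) convex_univ (mem_univ _)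
    (mem_univ _)
  simpa using this

/-- Mollification approximates the derivatives of a smooth function. -/
theorem norm_iteratedFDeriv_mollify_sub_le {φ : Eucl d → ℂ} (hφ : ContDiff ℝ ∞ φ)
    (hφs : HasCompactSupport φ) {i : ℕ} {r : ℝ}
    (hr : ∀ x, ‖iteratedFDeriv ℝ (i + 1) φ x‖ ≤ r) (ρ : ContDiffBump (0 : Eucl d)) (x : Eucl d) :
    ‖iteratedFDeriv ℝ i (fun x => ∫ y, ((ρ.normed volume y : ℝ) : ℂ) • φ (x - y)) x -
      iteratedFDeriv ℝ i φ x‖ ≤ r * ρ.rOut := by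
  have hρ : Continuous fun y => ((ρ.normed volume y : ℝ) : ℂ) :=
    Complex.continuous_ofReal.comp ρ.continuous_normed
  have hρs : HasCompactSupport fun y => ((ρ.normed volume y : ℝ) : ℂ) :=
    ρ.hasCompactSupport_normed.comp_left (g := fun t : ℝ => (t : ℂ)) (by simp)
  have hi : Continuous (iteratedFDeriv ℝ i φ) :=
    hφ.continuous_iteratedFDeriv (mod_cast le_top)
  have h1 : iteratedFDeriv ℝ i φ x =
      ∫ y, ((ρ.normed volume y : ℝ) : ℂ) • iteratedFDeriv ℝ i φ x := by
    rw [integral_smul_const, integral_complex_ofReal, ρ.integral_normed]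
    simp
  rw [iteratedFDeriv_integral_smul_comp_sub hρ i hφ hφs, h1, ← integral_sub]
  · have h2 : r * ρ.rOut = ∫ y, ρ.normed volume y * (r * ρ.rOut) := by
      rw [integral_mul_const, ρ.integral_normed, one_mul]
    rw [h2]
    refine norm_integral_le_of_norm_le (ρ.integrable_normed.mul_const _) (ae_of_all _ fun y => ?_)
    rw [← smul_sub, norm_smul, Complex.norm_real, Real.norm_of_nonneg (ρ.nonneg_normed y)]
    by_cases hy : y ∈ Metric.ball 0 ρ.rOut
    · refine mul_le_mul_of_nonneg_left ?_ (ρ.nonneg_normed y)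
      refine (norm_iteratedFDeriv_sub_le hφ hr x y).trans ?_
      gcongr
      · exact (norm_nonneg _).trans (hr x)
      · exact (mem_ball_zero_iff.1 hy).le
    · rw [← ρ.support_normed_eq (μ := volume), Function.notMem_support] at hy
      simp [hy]
  · exact (hρ.smul (hi.comp (continuous_const.sub continuous_id))).integrable_of_hasCompactSupport
      hρs.smul_right
  · exact (hρ.smul continuous_const).integrable_of_hasCompactSupport hρs.smul_right

theorem ofFun_apply {X : Opens (Eucl d)} {f : Eucl d → ℂ} (hf : ContinuousOn f X) (φ : 𝓓(X, ℂ)) :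
    ofFun X f φ = ∫ x, φ x * f x :=
  TestFunction.integralAgainstBilinCLM_eq_integral
    (hf.locallyIntegrableOn X.isOpen.measurableSet)

/-- A distribution is bounded by finitely many derivatives on each step `𝓓_K`. -/
theorem exists_seminorm_bound {X : Opens (Eucl d)} (u : Distr X) {K : Compacts (Eucl d)}
    (hK : (K : Set (Eucl d)) ⊆ X) :
    ∃ (s : Finset ℕ) (c : NNReal), ∀ f : 𝓓_{K}(Eucl d, ℂ),
      ‖u (TestFunction.ofSupportedIn hK f)‖ ≤ c * (s.sup fun i => N[ℂ]_{K, i}) f := by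
  let u' : 𝓓_{K}(Eucl d, ℂ) →L[ℂ] ℂ := u.comp (TestFunction.ofSupportedInCLM ℂ hK)
  obtain ⟨s, c, -, h⟩ := Seminorm.bound_of_continuous
    (ContDiffMapSupportedIn.withSeminorms ℂ (Eucl d) ℂ ⊤ K)
    ((normSeminorm ℂ ℂ).comp u'.toLinearMap) u'.continuous.norm
  exact ⟨s, c, fun f => h f⟩

/-- The tuple of the derivatives with orders in `s`. -/
def derivTuple (s : Finset ℕ) (f : Eucl d → ℂ) (x : Eucl d) (i : s) : Eucl d [×i.1]→L[ℝ] ℂ :=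
  iteratedFDeriv ℝ i.1 f x

theorem continuous_derivTuple (s : Finset ℕ) {f : Eucl d → ℂ} (hf : ContDiff ℝ ∞ f) :
    Continuous (derivTuple s f) :=
  continuous_pi fun _ => hf.continuous_iteratedFDeriv (mod_cast le_top)

theorem hasCompactSupport_derivTuple (s : Finset ℕ) {f : Eucl d → ℂ} (hf : HasCompactSupport f) :
    HasCompactSupport (derivTuple s f) := by
  refine HasCompactSupport.intro hf fun x hx => ?_
  funext i
  by_contra h
  exact hx (support_iteratedFDeriv_subset i.1 h)

theorem derivTuple_integral_smul_comp_sub (s : Finset ℕ) {h : Eucl d → ℂ} (hh : Continuous h)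
    {g : Eucl d → ℂ} (hg : ContDiff ℝ ∞ g) (hgs : HasCompactSupport g) (x : Eucl d) :
    derivTuple s (fun x => ∫ y, h y • g (x - y)) x = ∫ y, h y • derivTuple s g (x - y) := by
  funext i
  refine (iteratedFDeriv_integral_smul_comp_sub hh i.1 hg hgs x).trans ?_
  refine ((ContinuousLinearMap.proj (R := ℝ) (φ := fun i : s => Eucl d [×i.1]→L[ℝ] ℂ) i
    ).integral_comp_comm (φ := fun y => h y • derivTuple s g (x - y)) ?_)
  exact integrable_smul_comp_sub hh (continuous_derivTuple s hg)
    (hasCompactSupport_derivTuple s hgs) x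

/-- The approximant is a regularization of `u`, morally `f y = u (ρ (· - y))`. Then `∫ φ f` is `u`
applied to the mollification of `φ`, which is close to `φ` in the finitely many derivatives
controlling `u`, uniformly over `B`. -/
theorem exists_continuous_approx {X : Opens (Eucl d)} (u : Distr X) {B : Set 𝓓(X, ℂ)}
    (hB : IsVonNBounded ℂ B) {ε : ℝ} (hε : 0 < ε) :
    ∃ f : Eucl d → ℂ, Continuous f ∧ ∀ φ ∈ B, ‖u φ - ofFun X f φ‖ ≤ ε := by
  obtain ⟨K, hK, A, -, rfl⟩ := exists_isVonNBounded_supportedIn hB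
  -- Mollification enlarges supports, so the estimate for `u` is taken on a thickening of `K` still
  -- inside `X`.
  obtain ⟨δ₀, hδ₀, hKδ₀⟩ := K.isCompact.exists_cthickening_subset_open X.isOpen hK
  let K' : Compacts (Eucl d) := ⟨Metric.cthickening δ₀ K, K.isCompact.cthickening⟩
  have hK' : (K' : Set (Eucl d)) ⊆ X := hKδ₀
  have hKK' : (K : Set (Eucl d)) ⊆ K' := Metric.self_subset_cthickening _
  obtain ⟨s, c, hu⟩ := exists_seminorm_bound u hK'
  -- The mollification error in order `i` is paid for by one derivative more.
  choose r hr using fun i => exists_iteratedFDeriv_bound hB (i + 1)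
  obtain ⟨R, hR0, hR⟩ : ∃ R : ℝ, 0 < R ∧ ∀ i ∈ s, r i ≤ R :=
    ⟨∑ i ∈ s, |r i| + 1, by positivity, fun i hi => (le_abs_self _).trans
      ((Finset.single_le_sum (f := fun i => |r i|) (fun _ _ => abs_nonneg _) hi).trans
        (lt_add_one _).le)⟩
  obtain ⟨δ, hδ, hδδ₀, hδε⟩ : ∃ δ : ℝ, 0 < δ ∧ δ ≤ δ₀ ∧ c * (R * δ) ≤ ε := by
    refine ⟨min δ₀ (ε / ((c + 1) * R)), by positivity, min_le_left _ _, ?_⟩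
    calc c * (R * min δ₀ (ε / ((c + 1) * R))) ≤ (c + 1) * (R * (ε / ((c + 1) * R))) := by
          gcongr
          · simp
          · exact min_le_right _ _
      _ = ε := by field_simp
  let ρ : ContDiffBump (0 : Eucl d) := ⟨δ / 2, δ, by positivity, by linarith⟩
  let ρc : Eucl d → ℂ := fun y => ((ρ.normed volume y : ℝ) : ℂ)
  have hρ : ContDiff ℝ ∞ ρc := Complex.ofRealCLM.contDiff.comp (ρ.contDiff_normed (n := ⊤))
  have hρs : HasCompactSupport ρc :=
    ρ.hasCompactSupport_normed.comp_left (g := fun t : ℝ => (t : ℂ)) (by simp)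
  have hsmooth (f : 𝓓_{K'}(Eucl d, ℂ)) {i : ℕ} : ContDiff ℝ i f :=
    f.contDiff.of_le (mod_cast le_top)
  let D : 𝓓_{K'}(Eucl d, ℂ) →ₗ[ℂ] (Eucl d → ∀ i : s, Eucl d [×i.1]→L[ℝ] ℂ) :=
    { toFun f := derivTuple s f
      map_add' f g := by
        funext x i
        exact congrFun (iteratedFDeriv_add (hsmooth f) (hsmooth g)) x
      map_smul' a f := by
        funext x i
        exact iteratedFDeriv_const_smul_apply (hsmooth f).contDiffAt }
  have hsup (f : 𝓓_{K'}(Eucl d, ℂ)) (b : ℝ) (hb : 0 ≤ b)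
      (h : ∀ i ∈ s, ∀ x, ‖iteratedFDeriv ℝ i f x‖ ≤ b) :
      (s.sup fun i => N[ℂ]_{K', i}) f ≤ b := by
    refine Seminorm.finset_sup_apply_le hb fun i hi => ?_
    rw [ContDiffMapSupportedIn.seminorm_top_le_iff ℂ hb]
    exact fun x _ => h i hi x
  obtain ⟨f, hf, hfD⟩ := exists_continuous_density D
    (fun f => continuous_derivTuple s f.contDiff)
    (fun f => (continuous_derivTuple s f.contDiff).bounded_above_of_compact_support
      (hasCompactSupport_derivTuple s f.hasCompactSupport))
    (u.comp (TestFunction.ofSupportedInCLM ℂ hK')).toLinearMap c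
    (fun f b hb => (hu f).trans (mul_le_mul_of_nonneg_left (hsup f b
      ((norm_nonneg _).trans (hb 0)) fun i hi x =>
        (norm_le_pi_norm (derivTuple s f x) ⟨i, hi⟩).trans (hb x)) c.2))
    (continuous_derivTuple s hρ) (hasCompactSupport_derivTuple s hρs)
  refine ⟨f, hf, ?_⟩
  rintro _ ⟨φ, hφ, rfl⟩
  rw [ofFun_apply hf.continuousOn]
  let φ' : 𝓓_{K'}(Eucl d, ℂ) := .of_support_subset φ.contDiff (φ.support_subset.trans hKK')
  have hφ' : TestFunction.ofSupportedIn hK φ = TestFunction.ofSupportedIn hK' φ' := rfl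
  have hθsupp : Function.support (fun x => ∫ y, φ y • ρc (x - y)) ⊆ K' := by
    intro x hx
    by_contra hxK'
    refine hx (integral_eq_zero_of_ae (ae_of_all _ fun y => ?_))
    by_cases hy : y ∈ K
    · have : x - y ∉ Function.support (ρ.normed volume) := by
        rw [ρ.support_normed_eq, mem_ball_zero_iff, ← dist_eq_norm]
        intro hlt
        exact hxK' (Metric.mem_cthickening_of_dist_le x y δ₀ K hy (hlt.le.trans hδδ₀))
      rw [Function.notMem_support] at this
      simp [ρc, this]
    · have : φ y = 0 := φ.zero_on_compl hy
      simp [this]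
  let θ : 𝓓_{K'}(Eucl d, ℂ) := .of_support_subset
    (contDiff_integral_smul_comp_sub φ.continuous hρ hρs) hθsupp
  have hθ : (θ : Eucl d → ℂ) = fun x => ∫ y, φ y • ρc (x - y) := rfl
  -- Convolution is commutative: as a superposition of translates of `ρ`, `θ` fits the density
  -- lemma; as an average of translates of `φ`, it is close to `φ`.
  have hθ' : (θ : Eucl d → ℂ) = fun x => ∫ y, ρc y • φ (x - y) := by
    rw [hθ]
    funext x
    rw [← integral_sub_left_eq_self _ volume x]
    simp [mul_comm]
  have h1 := hfD φ φ.continuous φ.hasCompactSupport θ fun x =>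
    derivTuple_integral_smul_comp_sub s φ.continuous hρ hρs x
  have h2 : u (TestFunction.ofSupportedIn hK' θ) = ∫ y, φ y * f y := h1
  change ‖u (TestFunction.ofSupportedIn hK φ) - ∫ y, φ y * f y‖ ≤ ε
  rw [← h2, hφ', norm_sub_rev, ← map_sub]
  refine (hu (θ - φ')).trans (le_trans ?_ hδε)
  refine mul_le_mul_of_nonneg_left (hsup _ _ (by positivity) fun i hi x => ?_) c.2
  have h3 := norm_iteratedFDeriv_mollify_sub_le φ.contDiff φ.hasCompactSupport
    (fun x => hr i _ ⟨φ, hφ, rfl⟩ x) ρ x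
  have h4 : iteratedFDeriv ℝ i (θ - φ' : 𝓓_{K'}(Eucl d, ℂ)) x =
      iteratedFDeriv ℝ i θ x - iteratedFDeriv ℝ i φ x :=
    congrFun (iteratedFDeriv_sub (hsmooth θ) (hsmooth φ')) x
  rw [h4, hθ']
  refine h3.trans ?_
  gcongr
  exact hR i hi

theorem isVonNBounded_singleton_testFunction {X : Opens (Eucl d)} (φ : 𝓓(X, ℂ)) :
    IsVonNBounded ℂ {φ} := by
  let K : Compacts (Eucl d) := ⟨tsupport φ, φ.hasCompactSupport⟩
  have hK : (K : Set (Eucl d)) ⊆ X := φ.tsupport_subset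
  have := isVonNBounded_image_ofSupportedIn hK
    (isVonNBounded_singleton (𝕜 := ℂ) (.of_support_subset φ.contDiff subset_closure))
  rwa [image_singleton] at this

/-- Continuous operators on `𝒟'(X)` are determined by their values on continuous functions. -/
theorem ext_of_eq_on_ofFun {X : Opens (Eucl d)} {C₁ C₂ : Distr X →L[ℂ] Distr X}
    (h : ∀ f : Eucl d → ℂ, Continuous f → C₁ (ofFun X f) = C₂ (ofFun X f)) : C₁ = C₂ := by
  ext u φ
  let p : Seminorm ℂ (⊤ : Submodule ℂ (Distr X)) :=
    (supSeminorm (isVonNBounded_singleton_testFunction φ)).comp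
      ((C₁ - C₂).toLinearMap ∘ₗ Submodule.subtype ⊤)
  have hp : Continuous p :=
    (continuous_supSeminorm (isVonNBounded_singleton_testFunction φ)).comp
    ((C₁ - C₂).continuous.comp continuous_subtype_val)
  have hp_le (v : Distr X) : ‖(C₁ - C₂) v φ‖ ≤ p ⟨v, trivial⟩ :=
    le_supSeminorm (isVonNBounded_singleton_testFunction φ) ((C₁ - C₂) v) rfl
  obtain ⟨B, hB, c, hc, H⟩ := exists_bounded_of_continuous_seminorm p hp
  have key (ε : ℝ) (hε : 0 < ε) : ‖(C₁ - C₂) u φ‖ ≤ ε := by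
    obtain ⟨f, hf, hfB⟩ := exists_continuous_approx u hB (div_pos hε hc)
    have h1 := H ⟨u - ofFun X f, trivial⟩ (ε / c) (by positivity) hfB
    rw [mul_div_cancel₀ _ hc.ne'] at h1
    have h2 : (C₁ - C₂) (u - ofFun X f) = (C₁ - C₂) u := by
      rw [map_sub, sub_apply C₁ C₂ (ofFun X f), h f hf, sub_self, sub_zero]
    rw [← h2]
    exact (hp_le _).trans h1
  have h0 : (C₁ - C₂) u φ = 0 := norm_le_zero_iff.1 (le_of_forall_pos_le_add fun ε hε => by
    simpa using key ε hε)
  exact sub_eq_zero.1 h0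

end

section

open Set Filter Bornology Topology MeasureTheory

variable {d : ℕ}

/-! ### The transpose of the weighted composition operator -/

theorem natCast_le_infty (n : ℕ) : (n : ℕ∞ω) ≤ ∞ := mod_cast le_top

theorem contDiff_det : ContDiff ℝ ∞ fun A : Eucl d →L[ℝ] Eucl d => A.det := by
  let b := (EuclideanSpace.basisFun (Fin d) ℝ).toBasis
  have h (A : Eucl d →L[ℝ] Eucl d) : A.det = (LinearMap.toMatrix b b A.toLinearMap).det :=
    (LinearMap.det_toMatrix b _).symm
  simp_rw [h, Matrix.det_apply]
  refine ContDiff.sum fun σ _ => ContDiff.const_smul _ (contDiff_prod fun i _ => ?_)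
  let L : (Eucl d →L[ℝ] Eucl d) →ₗ[ℝ] ℝ :=
    { toFun A := LinearMap.toMatrix b b A.toLinearMap (σ i) i
      map_add' A B := by simp [LinearMap.toMatrix_apply]
      map_smul' c A := by simp [LinearMap.toMatrix_apply] }
  exact (LinearMap.toContinuousLinearMap L).contDiff

/-- Bounds for the derivatives of a weighted composition on compact sets. -/
theorem exists_bound_mul_comp {Y : Set (Eucl d)} (hY : IsOpen Y) {b : Eucl d → ℂ}
    (hb : ContDiffOn ℝ ∞ b Y) {g : Eucl d → Eucl d} (hg : ContDiffOn ℝ ∞ g Y) {K : Set (Eucl d)}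
    (hK : IsCompact K) (hKY : K ⊆ Y) (i : ℕ) :
    ∃ C : ℝ, 0 ≤ C ∧ ∀ φ : Eucl d → ℂ, ContDiff ℝ ∞ φ → ∀ M : ℝ,
      (∀ j ≤ i, ∀ x, ‖iteratedFDeriv ℝ j φ x‖ ≤ M) →
        ∀ y ∈ K, ‖iteratedFDerivWithin ℝ i (fun y => b y * φ (g y)) Y y‖ ≤ C * M := by
  have hYu := hY.uniqueDiffOn (𝕜 := ℝ)
  have bd {F : Type} [NormedAddCommGroup F] [NormedSpace ℝ F] {f : Eucl d → F}
      (hf : ContDiffOn ℝ ∞ f Y) : ∃ R : ℝ, 1 ≤ R ∧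
        ∀ j ≤ i, ∀ y ∈ K, ‖iteratedFDerivWithin ℝ j f Y y‖ ≤ R := by
    choose r hr using fun j : ℕ => hK.exists_bound_of_continuousOn
      ((hf.continuousOn_iteratedFDerivWithin (m := j) (mod_cast le_top) hYu).mono hKY)
    refine ⟨1 + ∑ j ∈ Finset.range (i + 1), |r j|, le_add_of_nonneg_right (by positivity),
      fun j hj y hy => (hr j y hy).trans ((le_abs_self _).trans ?_)⟩
    have := Finset.single_le_sum (f := fun j => |r j|) (fun _ _ => abs_nonneg _)
      (Finset.mem_range.2 (Nat.lt_succ_of_le hj))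
    linarith
  obtain ⟨Rb, hRb1, hRb⟩ := bd hb
  obtain ⟨Rg, hRg1, hRg⟩ := bd hg
  refine ⟨∑ j ∈ Finset.range (i + 1), (i.choose j : ℝ) * Rb * ((i - j).factorial * Rg ^ (i - j)),
    by positivity, fun φ hφ M hM y hy => ?_⟩
  have hφg : ContDiffOn ℝ ∞ (fun y => φ (g y)) Y := hφ.comp_contDiffOn hg
  refine (norm_iteratedFDerivWithin_mul_le hb hφg hYu (hKY hy) (n := i)
    (mod_cast le_top)).trans ?_
  rw [Finset.sum_mul]
  refine Finset.sum_le_sum fun j hj => ?_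
  have hj' : j ≤ i := Nat.lt_succ_iff.1 (Finset.mem_range.1 hj)
  have h1 : ‖iteratedFDerivWithin ℝ (i - j) (φ ∘ g) Y y‖ ≤
      (i - j).factorial * M * Rg ^ (i - j) := by
    refine norm_iteratedFDerivWithin_comp_le (N := ∞) (t := univ) hφ.contDiffOn hg
      (natCast_le_infty _) uniqueDiffOn_univ hYu (mapsTo_univ _ _) (hKY hy) (fun k hk => ?_)
      (fun k hk1 hk => ?_)
    · rw [iteratedFDerivWithin_univ]
      exact hM k (hk.trans (Nat.sub_le _ _)) _
    · exact (hRg k (hk.trans (Nat.sub_le _ _)) y hy).trans (le_self_pow₀ hRg1 (by omega))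
  calc _ ≤ (i.choose j : ℝ) * Rb * ((i - j).factorial * M * Rg ^ (i - j)) := by
        gcongr
        · exact hRb j hj' y hy
        · exact h1
    _ = _ := by ring

theorem hasStrictFDerivAt_of_det_ne_zero {ψ : Eucl d → Eucl d} {x : Eucl d} (hψ : ContDiffAt ℝ ∞ ψ x)
    (hdet : (fderiv ℝ ψ x).det ≠ 0) : HasStrictFDerivAt ψ
      (((fderiv ℝ ψ x).toContinuousLinearEquivOfDetNeZero hdet : Eucl d ≃L[ℝ] Eucl d) :
        Eucl d →L[ℝ] Eucl d) x := by
  rw [ContinuousLinearMap.coe_toContinuousLinearEquivOfDetNeZero]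
  exact hψ.hasStrictFDerivAt (by simp)

theorem isOpen_image_of_det_ne_zero {X : Opens (Eucl d)} {ψ : Eucl d → Eucl d}
    (hψ : ContDiffOn ℝ ∞ ψ X) (hψdet : ∀ x ∈ X, (fderiv ℝ ψ x).det ≠ 0)
    {U : Set (Eucl d)} (hU : IsOpen U) (hUX : U ⊆ X) :
    IsOpen (ψ '' U) := by
  rw [isOpen_iff_mem_nhds]
  rintro _ ⟨x, hx, rfl⟩
  rw [← (hasStrictFDerivAt_of_det_ne_zero (hψ.contDiffAt (X.isOpen.mem_nhds (hUX hx)))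
    (hψdet x (hUX hx))).map_nhds_eq_of_equiv]
  exact image_mem_map (hU.mem_nhds hx)

theorem contDiffOn_invFunOn {X : Opens (Eucl d)} {ψ : Eucl d → Eucl d}
    (hψ : ContDiffOn ℝ ∞ ψ X) (hψdet : ∀ x ∈ X, (fderiv ℝ ψ x).det ≠ 0)
    (hψinj : InjOn ψ X) :
    ContDiffOn ℝ ∞ (Function.invFunOn ψ X) (ψ '' X) := by
  let e : OpenPartialHomeomorph (Eucl d) (Eucl d) :=
    .ofContinuousOpenRestrict (hψinj.toPartialEquiv ψ X) hψ.continuousOn (by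
      intro U hU
      obtain ⟨V, hV, rfl⟩ := isOpen_induced_iff.1 hU
      have : (X : Set (Eucl d)).domRestrict ψ '' (Subtype.val ⁻¹' V) = ψ '' (V ∩ X) := by
        ext y
        simp only [mem_image, mem_preimage, Subtype.exists, domRestrict_apply, mem_inter_iff]
        constructor
        · rintro ⟨x, hx, hxV, rfl⟩
          exact ⟨x, ⟨hxV, hx⟩, rfl⟩
        · rintro ⟨x, ⟨hxV, hx⟩, rfl⟩
          exact ⟨x, hx, hxV, rfl⟩
      change IsOpen ((X : Set (Eucl d)).domRestrict ψ '' (Subtype.val ⁻¹' V))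
      rw [this]
      exact isOpen_image_of_det_ne_zero hψ hψdet (hV.inter X.isOpen) inter_subset_right) X.isOpen
  intro y hy
  have hy' : e.symm y ∈ (X : Set (Eucl d)) := e.map_target hy
  have hc : ContDiffAt ℝ ∞ ψ (e.symm y) := hψ.contDiffAt (X.isOpen.mem_nhds hy')
  exact (e.contDiffAt_symm hy (hasStrictFDerivAt_of_det_ne_zero hc (hψdet _ hy')).hasFDerivAt
    hc).contDiffWithinAt

/-- The weight of the transpose of the weighted composition operator. -/
def transposeWeight (X : Opens (Eucl d)) (w : Eucl d → ℂ) (ψ : Eucl d → Eucl d) (y : Eucl d) : ℂ :=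
  w (Function.invFunOn ψ X y) * ((|(fderiv ℝ ψ (Function.invFunOn ψ X y)).det|⁻¹ : ℝ) : ℂ)

theorem contDiffOn_abs_det {X : Opens (Eucl d)} {ψ : Eucl d → Eucl d}
    (hψ : ContDiffOn ℝ ∞ ψ X) (hψdet : ∀ x ∈ X, (fderiv ℝ ψ x).det ≠ 0) :
    ContDiffOn ℝ ∞ (fun x => |(fderiv ℝ ψ x).det|) X := by
  intro x hx
  have h1 : ContDiffAt ℝ ∞ (fderiv ℝ ψ) x :=
    (hψ.contDiffAt (X.isOpen.mem_nhds hx)).fderiv_right (by simp)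
  exact ((contDiff_det.contDiffAt.comp x h1).abs (hψdet x hx)).contDiffWithinAt

theorem contDiffOn_transposeWeight {X : Opens (Eucl d)} {w : Eucl d → ℂ}
    (hw : ContDiffOn ℝ ∞ w X) {ψ : Eucl d → Eucl d} (hψ : ContDiffOn ℝ ∞ ψ X)
    (hψinj : InjOn ψ X) (hψdet : ∀ x ∈ X, (fderiv ℝ ψ x).det ≠ 0) :
    ContDiffOn ℝ ∞ (transposeWeight X w ψ) (ψ '' X) := by
  have hg := contDiffOn_invFunOn hψ hψdet hψinj
  have hmaps : MapsTo (Function.invFunOn ψ X) (ψ '' X) X := fun y hy => Function.invFunOn_mem hy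
  have h1 : ContDiffOn ℝ ∞ (fun x => |(fderiv ℝ ψ x).det|⁻¹) X :=
    (contDiffOn_abs_det hψ hψdet).inv fun x hx => abs_ne_zero.2 (hψdet x hx)
  exact (hw.comp hg hmaps).mul
    (Complex.ofRealCLM.contDiff.comp_contDiffOn (h1.comp hg hmaps))

theorem contDiff_of_contDiffOn_of_support_subset {F : Type*} [NormedAddCommGroup F]
    [NormedSpace ℝ F] {Y K : Set (Eucl d)} (hY : IsOpen Y) (hK : IsClosed K) (hKY : K ⊆ Y)
    {f : Eucl d → F} (hf : ContDiffOn ℝ ∞ f Y) (hfK : Function.support f ⊆ K) :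
    ContDiff ℝ ∞ f := by
  rw [contDiff_iff_contDiffAt]
  intro x
  by_cases hx : x ∈ Y
  · exact hf.contDiffAt (hY.mem_nhds hx)
  · refine (contDiffAt_const (c := 0)).congr_of_eventuallyEq ?_
    filter_upwards [hK.isOpen_compl.mem_nhds fun h => hx (hKY h)] with y hy
    exact Function.notMem_support.1 fun h => hy (hfK h)

/-- `T` is the transpose of the weighted composition operator with weight `w` and symbol `ψ`. -/
structure IsTranspose (X : Opens (Eucl d)) (w : Eucl d → ℂ) (ψ : Eucl d → Eucl d)
    (T : 𝓓(X, ℂ) →L[ℂ] 𝓓(X, ℂ)) : Prop where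
  apply_map : ∀ φ, ∀ x ∈ X, T φ (ψ x) = w x * ((|(fderiv ℝ ψ x).det|⁻¹ : ℝ) : ℂ) * φ x
  eq_zero : ∀ φ, ∀ y ∉ ψ '' X, T φ y = 0

/-- Extension by zero from the open set `ψ(X)` stays smooth since a support `K` is carried into the
compact set `ψ(K) ⊆ ψ(X)`. Continuity is checked on each step, as a map `𝓓_K → 𝓓_{ψ(K)}`. -/
theorem exists_transpose {X : Opens (Eucl d)} {w : Eucl d → ℂ}
    (hw : ContDiffOn ℝ ∞ w X) {ψ : Eucl d → Eucl d} (hψmaps : MapsTo ψ X X)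
    (hψ : ContDiffOn ℝ ∞ ψ X)
    (hψinj : InjOn ψ X) (hψdet : ∀ x ∈ X, (fderiv ℝ ψ x).det ≠ 0) :
    ∃ T : 𝓓(X, ℂ) →L[ℂ] 𝓓(X, ℂ), IsTranspose X w ψ T := by
  have hY : IsOpen (ψ '' X) := isOpen_image_of_det_ne_zero hψ hψdet X.isOpen subset_rfl
  have hg := contDiffOn_invFunOn hψ hψdet hψinj
  have hb := contDiffOn_transposeWeight hw hψ hψinj hψdet
  let F (φ : Eucl d → ℂ) : Eucl d → ℂ := (ψ '' X).indicator
    fun y => transposeWeight X w ψ y * φ (Function.invFunOn ψ X y)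
  have hF (φ : Eucl d → ℂ) : EqOn (F φ)
      (fun y => transposeWeight X w ψ y * φ (Function.invFunOn ψ X y)) (ψ '' X) :=
    fun y hy => indicator_of_mem hy _
  have hFadd (φ θ : Eucl d → ℂ) (y) : F (φ + θ) y = F φ y + F θ y := by
    by_cases hy : y ∈ ψ '' X
    · simp [hF _ hy, mul_add]
    · simp [F, indicator_of_notMem hy]
  have hFsmul (c : ℂ) (φ : Eucl d → ℂ) (y) : F (c • φ) y = c • F φ y := by
    by_cases hy : y ∈ ψ '' X
    · simp [hF _ hy]; ring
    · simp [F, indicator_of_notMem hy]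
  have hFs {φ : Eucl d → ℂ} {K : Set (Eucl d)} (hφ : Function.support φ ⊆ K) :
      Function.support (F φ) ⊆ ψ '' K := by
    intro y hy
    have hyX : y ∈ ψ '' X := mem_of_indicator_ne_zero hy
    rw [Function.mem_support, hF _ hyX] at hy
    exact ⟨_, hφ (right_ne_zero_of_mul hy), Function.invFunOn_eq hyX⟩
  have hFc {φ : Eucl d → ℂ} (hφ : ContDiff ℝ ∞ φ) : ContDiffOn ℝ ∞ (F φ) (ψ '' X) :=
    (hb.mul (hφ.comp_contDiffOn hg)).congr (hF φ)
  have hψK {K : Set (Eucl d)} (hK : IsCompact K) (hKX : K ⊆ X) : IsCompact (ψ '' K) :=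
    hK.image_of_continuousOn (hψ.continuousOn.mono hKX)
  have hFsmooth {φ : Eucl d → ℂ} (hφ : ContDiff ℝ ∞ φ) {K : Set (Eucl d)} (hK : IsCompact K)
      (hKX : K ⊆ X) (hφK : Function.support φ ⊆ K) : ContDiff ℝ ∞ (F φ) :=
    contDiff_of_contDiffOn_of_support_subset hY (hψK hK hKX).isClosed (image_mono hKX) (hFc hφ)
      (hFs hφK)
  let Φ (φ : 𝓓(X, ℂ)) : 𝓓(X, ℂ) :=
    { toFun := F φ
      contDiff' := hFsmooth φ.contDiff φ.hasCompactSupport φ.tsupport_subset subset_closure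
      hasCompactSupport' := .of_support_subset_isCompact
        (hψK φ.hasCompactSupport φ.tsupport_subset) (hFs subset_closure)
      tsupport_subset' := (closure_minimal (hFs subset_closure)
        (hψK φ.hasCompactSupport φ.tsupport_subset).isClosed).trans
          (hψmaps.mono_left φ.tsupport_subset).image_subset }
  let ψK (K : Compacts (Eucl d)) (hK : (K : Set (Eucl d)) ⊆ X) : Compacts (Eucl d) :=
    ⟨ψ '' K, hψK K.isCompact hK⟩
  have hψKX (K : Compacts (Eucl d)) (hK : (K : Set (Eucl d)) ⊆ X) :
      (ψK K hK : Set (Eucl d)) ⊆ X := (hψmaps.mono_left hK).image_subset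
  let T (K : Compacts (Eucl d)) (hK : (K : Set (Eucl d)) ⊆ X) :
      𝓓_{K}(Eucl d, ℂ) →L[ℂ] 𝓓_{ψK K hK}(Eucl d, ℂ) :=
    ContDiffMapSupportedIn.mkCLM ℂ (fun f => F f) (fun f g y => hFadd f g y)
      (fun c f y => hFsmul c f y) (fun f => hFsmooth f.contDiff K.isCompact hK f.support_subset)
      (fun f => Function.support_subset_iff'.1 (hFs f.support_subset)) fun i _ => by
        obtain ⟨C, hC, H⟩ := exists_bound_mul_comp hY hb hg (ψK K hK).isCompact
          (image_mono hK) i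
        refine ⟨Finset.Iic i, C, hC, fun f y hy => ?_⟩
        have hyY : y ∈ ψ '' X := image_mono hK hy
        rw [← iteratedFDerivWithin_of_isOpen i hY hyY, iteratedFDerivWithin_congr (hF f) hyY]
        refine H f f.contDiff _ (fun j hj x => ?_) y hy
        exact (ContDiffMapSupportedIn.norm_iteratedFDeriv_apply_le_seminorm_top ℂ).trans
          (Seminorm.le_finset_sup_apply (Finset.mem_Iic.2 hj))
  refine ⟨TestFunction.limitCLM ℂ Φ
    (fun K hK => (TestFunction.ofSupportedInCLM ℂ (hψKX K hK)).comp (T K hK))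
    (fun K hK f => rfl), fun φ x hx => ?_, fun φ y hy => ?_⟩
  · have hx' : ψ x ∈ ψ '' X := mem_image_of_mem ψ hx
    change F φ (ψ x) = _
    rw [hF φ hx']
    simp only [transposeWeight, hψinj.leftInvOn_invFunOn hx]
  · change F φ y = 0
    exact indicator_of_notMem hy _

theorem IsTranspose.support_subset {X : Opens (Eucl d)} {w : Eucl d → ℂ} {ψ : Eucl d → Eucl d}
    {T : 𝓓(X, ℂ) →L[ℂ] 𝓓(X, ℂ)} (hT : IsTranspose X w ψ T) (φ : 𝓓(X, ℂ)) :
    Function.support (T φ) ⊆ ψ '' Function.support φ := by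
  intro y hy
  by_cases hyX : y ∈ ψ '' X
  · obtain ⟨x, hx, rfl⟩ := hyX
    rw [Function.mem_support, hT.apply_map φ x hx] at hy
    exact mem_image_of_mem ψ (right_ne_zero_of_mul hy)
  · exact absurd (hT.eq_zero φ y hyX) hy

theorem IsTranspose.support_pow_subset {X : Opens (Eucl d)} {w : Eucl d → ℂ}
    {ψ : Eucl d → Eucl d} {T : 𝓓(X, ℂ) →L[ℂ] 𝓓(X, ℂ)} (hT : IsTranspose X w ψ T) (m : ℕ)
    (φ : 𝓓(X, ℂ)) : Function.support ((T ^ m) φ) ⊆ ψ^[m] '' Function.support φ := by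
  induction m generalizing φ with
  | zero => simp
  | succ m ih =>
    rw [pow_succ, Function.iterate_succ, image_comp]
    exact (ih (T φ)).trans (image_mono (hT.support_subset φ))

theorem IsTranspose.isWeightedCompositionOperator {X : Opens (Eucl d)} {w : Eucl d → ℂ}
    (hw : ContDiffOn ℝ ∞ w X) {ψ : Eucl d → Eucl d} (hψmaps : MapsTo ψ X X)
    (hψ : ContDiffOn ℝ ∞ ψ X) (hψinj : InjOn ψ X) (hψdet : ∀ x ∈ X, (fderiv ℝ ψ x).det ≠ 0)
    {T : 𝓓(X, ℂ) →L[ℂ] 𝓓(X, ℂ)} (hT : IsTranspose X w ψ T) :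
    IsWeightedCompositionOperator X w ψ (ContinuousLinearMap.precomp ℂ T) := by
  intro f hf
  ext φ
  change ofFun X f (T φ) = _
  have hwf : ContinuousOn (fun x => w x * f (ψ x)) X :=
    hw.continuousOn.mul (hf.comp hψ.continuousOn hψmaps)
  have h1 : ∫ y in ψ '' X, T φ y * f y = ∫ y, T φ y * f y :=
    setIntegral_eq_integral_of_forall_compl_eq_zero
      fun y hy => by rw [hT.eq_zero φ y hy, zero_mul]
  have h2 : ∫ x in X, φ x * (w x * f (ψ x)) = ∫ x, φ x * (w x * f (ψ x)) :=
    setIntegral_eq_integral_of_forall_compl_eq_zero fun x hx => by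
      rw [image_eq_zero_of_notMem_tsupport fun h => hx (φ.tsupport_subset h), zero_mul]
  rw [ofFun_apply hf, ofFun_apply hwf, ← h1, ← h2,
    integral_image_eq_integral_abs_det_fderiv_smul volume X.isOpen.measurableSet
      (fun x hx => ((hψ.contDiffAt (X.isOpen.mem_nhds hx)).differentiableAt
        (by simp)).hasFDerivAt.hasFDerivWithinAt) hψinj]
  refine setIntegral_congr_fun X.isOpen.measurableSet fun x hx => ?_
  have h0 : ((|(fderiv ℝ ψ x).det| : ℝ) : ℂ) ≠ 0 :=
    Complex.ofReal_ne_zero.2 (abs_ne_zero.2 (hψdet x hx))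
  rw [hT.apply_map φ x hx, Complex.real_smul, Complex.ofReal_inv]
  field_simp

/-- Where `w` does not vanish, `T` is inverted by composing with `ψ`, multiplying by the Jacobian
and dividing by `w`. -/
theorem IsTranspose.exists_preimage {X : Opens (Eucl d)} {w : Eucl d → ℂ}
    (hw : ContDiffOn ℝ ∞ w X) {ψ : Eucl d → Eucl d}
    (hψ : ContDiffOn ℝ ∞ ψ X) (hψinj : InjOn ψ X) (hψdet : ∀ x ∈ X, (fderiv ℝ ψ x).det ≠ 0)
    {T : 𝓓(X, ℂ) →L[ℂ] 𝓓(X, ℂ)} (hT : IsTranspose X w ψ T) {O : Set (Eucl d)} (hO : IsOpen O)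
    (hOX : O ⊆ X) (hwO : ∀ x ∈ O, w x ≠ 0) (χ : 𝓓(X, ℂ)) (hχ : tsupport χ ⊆ ψ '' O) :
    ∃ φ : 𝓓(X, ℂ), T φ = χ ∧ tsupport φ ⊆ O := by
  let K : Set (Eucl d) := Function.invFunOn ψ X '' tsupport χ
  have hKc : IsCompact K := χ.hasCompactSupport.isCompact.image_of_continuousOn
    ((contDiffOn_invFunOn hψ hψdet hψinj).continuousOn.mono (hχ.trans (image_mono hOX)))
  have hKO : K ⊆ O := by
    rintro _ ⟨y, hy, rfl⟩
    obtain ⟨x, hx, rfl⟩ := hχ hy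
    rwa [hψinj.leftInvOn_invFunOn (hOX hx)]
  let f : Eucl d → ℂ := O.indicator fun x => χ (ψ x) * ((|(fderiv ℝ ψ x).det| : ℝ) : ℂ) * (w x)⁻¹
  have hf : EqOn f (fun x => χ (ψ x) * ((|(fderiv ℝ ψ x).det| : ℝ) : ℂ) * (w x)⁻¹) O :=
    fun x hx => indicator_of_mem hx _
  have hfK : Function.support f ⊆ K := by
    intro x hx
    have hxO : x ∈ O := mem_of_indicator_ne_zero hx
    rw [Function.mem_support, hf hxO] at hx
    exact ⟨ψ x, subset_closure (left_ne_zero_of_mul (left_ne_zero_of_mul hx)),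
      hψinj.leftInvOn_invFunOn (hOX hxO)⟩
  have hfs : ContDiff ℝ ∞ f := by
    refine contDiff_of_contDiffOn_of_support_subset hO hKc.isClosed hKO ?_ hfK
    refine ContDiffOn.congr ?_ hf
    exact ((χ.contDiff.comp_contDiffOn (hψ.mono hOX)).mul
      (Complex.ofRealCLM.contDiff.comp_contDiffOn ((contDiffOn_abs_det hψ hψdet).mono hOX))).mul
      ((hw.mono hOX).inv hwO)
  have hfts : tsupport f ⊆ O := (closure_minimal hfK hKc.isClosed).trans hKO
  refine ⟨⟨f, hfs, .of_support_subset_isCompact hKc hfK, hfts.trans hOX⟩, ?_, hfts⟩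
  ext y
  by_cases hy : y ∈ ψ '' O
  · obtain ⟨x, hx, rfl⟩ := hy
    have h0 : ((|(fderiv ℝ ψ x).det| : ℝ) : ℂ) ≠ 0 :=
      Complex.ofReal_ne_zero.2 (abs_ne_zero.2 (hψdet x (hOX hx)))
    have h1 := hwO x hx
    rw [hT.apply_map _ x (hOX hx), TestFunction.coe_mk, hf hx, Complex.ofReal_inv]
    field_simp
  · rw [image_eq_zero_of_notMem_tsupport fun h => hy (hχ h)]
    by_contra h
    obtain ⟨x, hx, rfl⟩ := hT.support_subset _ h
    exact hy ⟨x, hfts (subset_closure hx), rfl⟩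

end

section

open Set Filter Bornology Topology

variable {d : ℕ}

/-! ### Topologizability and stable orbits -/

theorem clm_pow_succ_apply {E : Type*} [AddCommGroup E] [Module ℂ E] [TopologicalSpace E]
    (T : E →L[ℂ] E) (m : ℕ) (x : E) : (T ^ (m + 1)) x = (T ^ m) (T x) := by
  rw [pow_succ]
  rfl

theorem restrictOp_precomp_pow_apply {X : Opens (Eucl d)} (T : 𝓓(X, ℂ) →L[ℂ] 𝓓(X, ℂ))
    (V : Submodule ℂ (Distr X)) (hV : ∀ u ∈ V, ContinuousLinearMap.precomp ℂ T u ∈ V) (m : ℕ)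
    (u : V) (φ : 𝓓(X, ℂ)) :
    ((restrictOp (ContinuousLinearMap.precomp ℂ T) V hV ^ m) u).1 φ = u.1 ((T ^ m) φ) := by
  induction m generalizing u with
  | zero => rfl
  | succ m ih =>
    rw [clm_pow_succ_apply (restrictOp _ V hV) m u, pow_succ' T m]
    exact ih _

theorem IsTranspose.isTopologizable {X : Opens (Eucl d)} {w : Eucl d → ℂ} {ψ : Eucl d → Eucl d}
    {T : 𝓓(X, ℂ) →L[ℂ] 𝓓(X, ℂ)} (hT : IsTranspose X w ψ T) (V : Submodule ℂ (Distr X))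
    (hV : ∀ u ∈ V, ContinuousLinearMap.precomp ℂ T u ∈ V) (hψ : HasStableOrbits X ψ) :
    IsTopologizable (E := V) (restrictOp (ContinuousLinearMap.precomp ℂ T) V hV) := by
  intro p hp
  obtain ⟨B, hB, c, hc, hpB⟩ := exists_bounded_of_continuous_seminorm p hp
  obtain ⟨K, hKX, hK⟩ := exists_common_support hB
  obtain ⟨L, hLc, hLX, hL⟩ := hψ K K.isCompact hKX
  let L' : Compacts (Eucl d) := ⟨L, hLc⟩
  have hL'X : (L' : Set (Eucl d)) ⊆ X := hLX
  -- For `m ≥ 1` the preimage captures all of `T^m(B)`. For `m = 0` it may lose elements, which is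
  -- harmless as only `m ≥ 1` is required.
  obtain ⟨a, ha, hA⟩ := exists_isVonNBounded_iUnion_smul
    (fun m => TestFunction.ofSupportedIn hL'X ⁻¹' ((T ^ m) '' B))
    (fun m => isVonNBounded_preimage_ofSupportedIn hL'X (hB.image (T ^ m)))
  have hB' := isVonNBounded_image_ofSupportedIn hL'X hA
  refine ⟨(supSeminorm hB').comp V.subtype,
    (continuous_supSeminorm hB').comp continuous_subtype_val, fun m hm => ?_⟩
  refine ⟨c * (a m)⁻¹, mul_pos hc (inv_pos.2 (ha m)), fun u => ?_⟩
  rw [mul_assoc]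
  refine hpB _ _ (mul_nonneg (inv_pos.2 (ha m)).le (apply_nonneg _ _)) fun φ hφ => ?_
  rw [restrictOp_precomp_pow_apply, le_inv_mul_iff₀ (ha m)]
  have hsupp : Function.support ((T ^ m) φ) ⊆ L' :=
    (hT.support_pow_subset m φ).trans ((image_mono (hK φ hφ)).trans (hL m hm))
  let f : 𝓓_{L'}(Eucl d, ℂ) := .of_support_subset ((T ^ m) φ).contDiff hsupp
  have hf : TestFunction.ofSupportedIn hL'X f = (T ^ m) φ := rfl
  have hmem : (a m : ℂ) • (T ^ m) φ ∈ TestFunction.ofSupportedIn hL'X ''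
      ⋃ m, (fun f => (a m : ℂ) • f) '' (TestFunction.ofSupportedIn hL'X ⁻¹' ((T ^ m) '' B)) :=
    ⟨(a m : ℂ) • f, mem_iUnion.2 ⟨m, f, ⟨φ, hφ, rfl⟩, rfl⟩, rfl⟩
  have := le_supSeminorm hB' u.1 hmem
  rwa [map_smul, norm_smul, Complex.norm_real, Real.norm_of_nonneg (ha m).le] at this

theorem isOpen_iterate_image {X : Opens (Eucl d)} {ψ : Eucl d → Eucl d} (hψmaps : MapsTo ψ X X)
    (hψ : ContDiffOn ℝ ∞ ψ X) (hψdet : ∀ x ∈ X, (fderiv ℝ ψ x).det ≠ 0) (m : ℕ)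
    {U : Set (Eucl d)} (hU : IsOpen U) (hUX : U ⊆ X) : IsOpen (ψ^[m] '' U) := by
  induction m generalizing U with
  | zero => simpa
  | succ m ih =>
    rw [Function.iterate_succ, image_comp]
    exact ih (isOpen_image_of_det_ne_zero hψ hψdet hU hUX) (hψmaps.mono_left hUX).image_subset

/-- Each condition is open and dense, so finitely many hold together on a smaller open set. The
range `l < m` consists of the weights that enter `T^m`. -/
theorem exists_isOpen_forall_weight_ne_zero {X : Opens (Eucl d)} {w : Eucl d → ℂ}
    (hw : ContinuousOn w X) {ψ : Eucl d → Eucl d} (hψmaps : MapsTo ψ X X) (hψ : ContinuousOn ψ X)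
    (hC : ConditionC X w ψ) {U : Set (Eucl d)} (hU : IsOpen U) (hUX : U ⊆ X) (hUne : U.Nonempty)
    (m : ℕ) : ∃ U' ⊆ U, IsOpen U' ∧ U'.Nonempty ∧ ∀ l < m, ∀ x ∈ U', w (ψ^[l] x) ≠ 0 := by
  induction m with
  | zero => exact ⟨U, subset_rfl, hU, hUne, by simp⟩
  | succ m ih =>
    obtain ⟨U', hU'U, hU', ⟨x, hx⟩, hne⟩ := ih
    have hcont : ContinuousOn (fun x => w (ψ^[m] x)) U' :=
      (hw.comp (hψ.iterate hψmaps m) (hψmaps.iterate m)).mono (hU'U.trans hUX)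
    refine ⟨U' ∩ (fun x => w (ψ^[m] x)) ⁻¹' {0}ᶜ, inter_subset_left.trans hU'U,
      hcont.isOpen_inter_preimage hU' isOpen_compl_singleton, ?_, fun l hl x hx => ?_⟩
    · obtain ⟨z, hz, hz'⟩ := mem_closure_iff.1 (hC m (hUX (hU'U hx))) U' hU' hx
      exact ⟨z, hz, hz'.2⟩
    · rcases Nat.lt_succ_iff_lt_or_eq.1 hl with h | rfl
      · exact hne l h x hx.1
      · exact hx.2

/-- Since `T^(m+1) = T^m ∘ T`, first `T^m` is inverted on `ψ(U)`, where the weight conditions shift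
by one index, and then `T` on `U`. -/
theorem IsTranspose.exists_pow_preimage {X : Opens (Eucl d)} {w : Eucl d → ℂ}
    (hw : ContDiffOn ℝ ∞ w X) {ψ : Eucl d → Eucl d} (hψmaps : MapsTo ψ X X)
    (hψ : ContDiffOn ℝ ∞ ψ X) (hψinj : InjOn ψ X) (hψdet : ∀ x ∈ X, (fderiv ℝ ψ x).det ≠ 0)
    {T : 𝓓(X, ℂ) →L[ℂ] 𝓓(X, ℂ)} (hT : IsTranspose X w ψ T) (m : ℕ) {U : Set (Eucl d)}
    (hU : IsOpen U) (hUX : U ⊆ X) (hwU : ∀ l < m, ∀ x ∈ U, w (ψ^[l] x) ≠ 0) (χ : 𝓓(X, ℂ))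
    (hχ : tsupport χ ⊆ ψ^[m] '' U) : ∃ φ : 𝓓(X, ℂ), (T ^ m) φ = χ ∧ tsupport φ ⊆ U := by
  induction m generalizing U with
  | zero => exact ⟨χ, rfl, by simpa using hχ⟩
  | succ m ih =>
    rw [Function.iterate_succ, image_comp] at hχ
    obtain ⟨φ₁, rfl, hφ₁⟩ := ih (isOpen_image_of_det_ne_zero hψ hψdet hU hUX)
      (hψmaps.mono_left hUX).image_subset (by
        rintro l hl _ ⟨x, hx, rfl⟩
        exact hwU (l + 1) (by omega) x hx) hχ
    obtain ⟨φ, rfl, hφ⟩ := hT.exists_preimage hw hψ hψinj hψdet hU hUX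
      (fun x hx => hwU 0 (Nat.succ_pos m) x hx) φ₁ hφ₁
    exact ⟨φ, by rw [pow_succ]; rfl, hφ⟩

theorem monoCLM_coe {X Y : Opens (Eucl d)} (h : Y ≤ X) (φ : 𝓓(Y, ℂ)) :
    ((TestFunction.monoCLM ℂ φ : 𝓓(X, ℂ)) : Eucl d → ℂ) = φ := by
  simp [h]

/-- Zero on `Y` and `h` on `Z` are compatible because the only test function on `Y ∩ Z = ∅` is zero.
-/
theorem exists_glue {G : SheafOfDistributions d} {Y Z : Opens (Eucl d)}
    (hYZ : Disjoint (Y : Set (Eucl d)) Z) {h : Distr Z} (hh : h ∈ G.obj Z) :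
    ∃ v ∈ G.obj (Y ⊔ Z), restrict Y v = 0 ∧ restrict Z v = h := by
  have hempty (φ : 𝓓(Y ⊓ Z, ℂ)) : φ = 0 := by
    ext x
    exact image_eq_zero_of_notMem_tsupport fun hx =>
      disjoint_left.1 hYZ (φ.tsupport_subset hx).1 (φ.tsupport_subset hx).2
  have hempty' (φ : 𝓓(Z ⊓ Y, ℂ)) : φ = 0 := by
    ext x
    exact image_eq_zero_of_notMem_tsupport fun hx =>
      disjoint_left.1 hYZ (φ.tsupport_subset hx).2 (φ.tsupport_subset hx).1
  let U : Bool → Opens (Eucl d) := fun b => if b then Y else Z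
  let u : (b : Bool) → Distr (U b) := fun b => match b with
    | true => (0 : Distr Y)
    | false => h
  obtain ⟨v, hv, hvu⟩ := G.gluing (Y ⊔ Z) U (by rw [iSup_bool_eq]; rfl) u
    (fun b => match b with
      | true => (G.obj Y).zero_mem
      | false => hh)
    (fun b b' => match b, b' with
      | true, true => rfl
      | false, false => rfl
      | true, false => by
        ext φ
        rw [show φ = 0 from hempty φ, map_zero, map_zero]
      | false, true => by
        ext φ
        rw [show φ = 0 from hempty' φ, map_zero, map_zero])
  exact ⟨v, hv, hvu true, hvu false⟩

theorem IsExhaustion.exists_subset {X : Opens (Eucl d)} {Xn : ℕ → Opens (Eucl d)}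
    (h : IsExhaustion X Xn) {K : Set (Eucl d)} (hK : IsCompact K) (hKX : K ⊆ X) :
    ∃ n, K ⊆ Xn n := by
  have hmono : Monotone fun n => (Xn n : Set (Eucl d)) :=
    monotone_nat_of_le_succ fun n => subset_closure.trans (h.closure_subset n)
  refine hK.elim_directed_cover _ (fun n => (Xn n).isOpen) ?_ hmono.directed_le
  rwa [← Opens.coe_iSup, h.iSup_eq]

theorem IsExhaustion.closure_subset_self {X : Opens (Eucl d)} {Xn : ℕ → Opens (Eucl d)}
    (h : IsExhaustion X Xn) (n : ℕ) : closure (Xn n : Set (Eucl d)) ⊆ X :=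
  (h.closure_subset n).trans (h.iSup_eq ▸ le_iSup Xn (n + 1))

/-- The inequality witnessing topologizability fails when orbits leave the set `Y` which carries
the dominating bounded set. -/
theorem exists_not_le_of_denseRange {G : SheafOfDistributions d} {X Y Z : Opens (Eucl d)}
    (hYZX : Y ⊔ Z ≤ X) (hYZ : Disjoint (Y : Set (Eucl d)) Z) (hdense : DenseRange (G.res hYZX))
    {h : Distr Z} (hh : h ∈ G.obj Z) {χ : 𝓓(Z, ℂ)} (hχ : h χ ≠ 0) {K : Compacts (Eucl d)}
    (hKY : (K : Set (Eucl d)) ⊆ Y) {A : Set 𝓓_{K}(Eucl d, ℂ)} (hA : IsVonNBounded ℂ A)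
    (hKX : (K : Set (Eucl d)) ⊆ X) (c : ℝ) :
    ∃ u : G.obj X, ∃ r : ℝ, 0 ≤ r ∧ (∀ f ∈ A, ‖u.1 (TestFunction.ofSupportedIn hKX f)‖ ≤ r) ∧
      c * r < ‖u.1 (TestFunction.monoCLM ℂ χ)‖ := by
  by_contra! hcon
  have hYW : Y ≤ Y ⊔ Z := le_sup_left
  have hZW : Z ≤ Y ⊔ Z := le_sup_right
  have hKW : (K : Set (Eucl d)) ⊆ (Y ⊔ Z : Opens (Eucl d)) := hKY.trans hYW
  have hB := isVonNBounded_image_ofSupportedIn hKW hA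
  let χW : 𝓓(Y ⊔ Z, ℂ) := TestFunction.monoCLM ℂ χ
  have hχW := isVonNBounded_singleton_testFunction χW
  have hχX : (TestFunction.monoCLM ℂ χW : 𝓓(X, ℂ)) = TestFunction.monoCLM ℂ χ := by
    ext x
    rw [monoCLM_coe hYZX, monoCLM_coe hZW, monoCLM_coe (hZW.trans hYZX)]
  -- The inequality is a closed condition on `v` and holds on the dense range of the restriction,
  -- hence everywhere. The glued element below violates it.
  have key (v : G.obj (Y ⊔ Z)) : supSeminorm hχW v.1 ≤ c * supSeminorm hB v.1 := by
    refine hdense.induction_on (p := fun v : G.obj (Y ⊔ Z) =>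
      supSeminorm hχW v.1 ≤ c * supSeminorm hB v.1) v ?_ fun u => ?_
    · exact isClosed_le ((continuous_supSeminorm hχW).comp continuous_subtype_val)
        (continuous_const.mul ((continuous_supSeminorm hB).comp continuous_subtype_val))
    · have h1 := hcon u (supSeminorm hB (G.res hYZX u).1) (apply_nonneg _ _) fun f hf => by
        refine le_trans (le_of_eq ?_) (le_supSeminorm hB (G.res hYZX u).1 ⟨f, hf, rfl⟩)
        change _ = ‖u.1 (TestFunction.monoCLM ℂ (TestFunction.ofSupportedIn hKW f))‖
        congr 2
        ext x
        rw [monoCLM_coe hYZX]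
        rfl
      refine supSeminorm_le hχW _ ((norm_nonneg _).trans h1) ?_
      rintro _ rfl
      change ‖u.1 (TestFunction.monoCLM ℂ χW)‖ ≤ _
      rwa [hχX]
  obtain ⟨v, hv, hvY, hvZ⟩ := exists_glue (G := G) hYZ hh
  have h0 : supSeminorm hB v ≤ 0 := by
    refine supSeminorm_le hB v le_rfl ?_
    rintro _ ⟨f, -, rfl⟩
    have h1 : restrict Y v (TestFunction.ofSupportedIn hKY f) = 0 := by rw [hvY]; rfl
    have h2 : (TestFunction.monoCLM ℂ (TestFunction.ofSupportedIn hKY f) : 𝓓(Y ⊔ Z, ℂ)) =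
        TestFunction.ofSupportedIn hKW f := by
      ext x
      rw [monoCLM_coe hYW]
      rfl
    rw [← h2]
    exact (congrArg norm h1).trans_le norm_zero.le
  have h1 := key ⟨v, hv⟩
  have h2 : v χW = h χ := by rw [← hvZ]; rfl
  have h3 := le_supSeminorm hχW v rfl
  rw [h2] at h3
  rw [le_antisymm h0 (apply_nonneg _ _), mul_zero] at h1
  exact hχ (norm_le_zero_iff.1 (h3.trans h1))

end

/-! ### Necessity of stable orbits -/

section

open Set Filter Bornology Topology

variable {d : ℕ}

/-- Escaping orbits produce, outside of `Y`, a ball together with a test function `χ` on it which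
is the `m`-th transposed image of a test function supported in `K`. -/
theorem IsTranspose.exists_escaping_testFunction {X : Opens (Eucl d)} {w : Eucl d → ℂ}
    (hw : ContDiffOn ℝ ∞ w X) {ψ : Eucl d → Eucl d} (hψmaps : MapsTo ψ X X)
    (hψ : ContDiffOn ℝ ∞ ψ X) (hψinj : InjOn ψ X) (hψdet : ∀ x ∈ X, (fderiv ℝ ψ x).det ≠ 0)
    {T : 𝓓(X, ℂ) →L[ℂ] 𝓓(X, ℂ)} (hT : IsTranspose X w ψ T) {G : SheafOfDistributions d}
    (hB : ConditionB G X) (hC : ConditionC X w ψ) {K : Compacts (Eucl d)}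
    (hKX : (K : Set (Eucl d)) ⊆ X) {Y : Set (Eucl d)} (hY : IsClosed Y) {m : ℕ}
    {x : Eucl d} (hxK : x ∈ interior (K : Set (Eucl d))) (hxY : ψ^[m] x ∉ Y) :
    ∃ (y : Eucl d) (ε : ℝ) (χ : 𝓓(ball y ε, ℂ)) (φ : 𝓓_{K}(Eucl d, ℂ)),
      0 < ε ∧ Metric.closedBall y ε ⊆ X \ Y ∧ (∃ h ∈ G.obj (ball y ε), h χ ≠ 0) ∧
      (T ^ m) (TestFunction.ofSupportedIn hKX φ) = TestFunction.monoCLM ℂ χ := by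
  have hintX : interior (K : Set (Eucl d)) ⊆ X := interior_subset.trans hKX
  obtain ⟨U, hU, hUo, ⟨z, hz⟩, hwU⟩ := exists_isOpen_forall_weight_ne_zero hw.continuousOn hψmaps
    hψ.continuousOn hC (((hψ.continuousOn.iterate hψmaps m).mono hintX).isOpen_inter_preimage
      isOpen_interior hY.isOpen_compl) (inter_subset_left.trans hintX) ⟨x, hxK, hxY⟩ m
  have hUX : U ⊆ X := hU.trans (inter_subset_left.trans hintX)
  obtain ⟨ε₀, hε₀, hB⟩ := hB
  obtain ⟨r, hr, hrU⟩ := Metric.nhds_basis_closedBall.mem_iff.1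
    ((isOpen_iterate_image hψmaps hψ hψdet m hUo hUX).mem_nhds (mem_image_of_mem _ hz))
  set y := ψ^[m] z
  -- Halving `ε₀` gives the strict bound demanded by condition b).
  let ε := min r (ε₀ / 2)
  have hε : 0 < ε := lt_min hr (half_pos hε₀)
  have hsub : Metric.closedBall y ε ⊆ ψ^[m] '' U :=
    (Metric.closedBall_subset_closedBall (min_le_left _ _)).trans hrU
  have hXY : Metric.closedBall y ε ⊆ X \ Y := by
    intro v hv
    obtain ⟨u, hu, rfl⟩ := hsub hv
    exact ⟨hψmaps.iterate m (hUX hu), (hU hu).2⟩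
  obtain ⟨χ₀, hχ₀⟩ := hB ε hε ((min_le_right _ _).trans_lt (half_lt_self hε₀))
  have hballX : ball y ε ≤ X := fun v hv => (hXY (Metric.ball_subset_closedBall hv)).1
  obtain ⟨φ, hφ, hφU⟩ := hT.exists_pow_preimage hw hψmaps hψ hψinj hψdet m hUo hUX hwU
    (TestFunction.monoCLM ℂ (translate y χ₀)) (by
      rw [monoCLM_coe hballX]
      exact (translate y χ₀).tsupport_subset.trans (Metric.ball_subset_closedBall.trans hsub))
  have hφK : Function.support φ ⊆ K :=
    subset_closure.trans (hφU.trans (hU.trans (inter_subset_left.trans interior_subset)))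
  refine ⟨y, ε, translate y χ₀, .of_support_subset φ.contDiff hφK, hε, hXY, ?_, hφ⟩
  exact hχ₀ y (hXY (Metric.mem_closedBall_self hε.le)).1
    (Metric.closure_ball_subset_closedBall.trans (hXY.trans sdiff_subset))

theorem IsTranspose.hasStableOrbits {X : Opens (Eucl d)} {w : Eucl d → ℂ}
    (hw : ContDiffOn ℝ ∞ w X) {ψ : Eucl d → Eucl d} (hψmaps : MapsTo ψ X X)
    (hψ : ContDiffOn ℝ ∞ ψ X) (hψinj : InjOn ψ X) (hψdet : ∀ x ∈ X, (fderiv ℝ ψ x).det ≠ 0)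
    {T : 𝓓(X, ℂ) →L[ℂ] 𝓓(X, ℂ)} (hT : IsTranspose X w ψ T) {G : SheafOfDistributions d}
    (hG : ∀ u ∈ G.obj X, ContinuousLinearMap.precomp ℂ T u ∈ G.obj X)
    (hA : ConditionA G X) (hB : ConditionB G X) (hC : ConditionC X w ψ)
    (htop : IsTopologizable (E := G.obj X)
      (restrictOp (ContinuousLinearMap.precomp ℂ T) (G.obj X) hG)) :
    HasStableOrbits X ψ := by
  obtain ⟨Xn, hXn, hdense⟩ := hA
  by_contra hstable
  unfold HasStableOrbits at hstable
  push Not at hstable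
  obtain ⟨K₀, hK₀, hK₀X, hesc⟩ := hstable
  -- A compact neighbourhood of `K₀` gives room to move an escaping point into an open set where the
  -- weights are nonzero.
  obtain ⟨K', hK', hK₀K, hK'X⟩ := exists_compact_between hK₀ X.isOpen hK₀X
  let K : Compacts (Eucl d) := ⟨K', hK'⟩
  have hKX : (K : Set (Eucl d)) ⊆ X := hK'X
  have hseq (n : ℕ) : ∃ (m : ℕ) (y : Eucl d) (ε : ℝ) (χ : 𝓓(ball y ε, ℂ)) (φ : 𝓓_{K}(Eucl d, ℂ)),
      1 ≤ m ∧ 0 < ε ∧ Metric.closedBall y ε ⊆ X \ closure (Xn n) ∧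
      (∃ h ∈ G.obj (ball y ε), h χ ≠ 0) ∧
      (T ^ m) (TestFunction.ofSupportedIn hKX φ) = TestFunction.monoCLM ℂ χ := by
    obtain ⟨m, hm, hmK⟩ := hesc _ (hXn.isCompact_closure n) (hXn.closure_subset_self n)
    obtain ⟨_, ⟨x, hx, rfl⟩, hxn⟩ := not_subset.1 hmK
    obtain ⟨y, ε, χ, φ, h⟩ := hT.exists_escaping_testFunction hw hψmaps hψ hψinj hψdet hB hC hKX
      isClosed_closure (hK₀K hx) hxn
    exact ⟨m, y, ε, χ, φ, hm, h⟩
  choose m y ε χ φ hm hε hball hh hφ using hseq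
  -- The seminorm `p` must be fixed before `q` is known, so one bounded set collects suitable
  -- multiples of the `φ n` for all `n`.
  obtain ⟨a, ha, haB⟩ := exists_isVonNBounded_iUnion_smul (fun n => {φ n})
    fun n => isVonNBounded_singleton (𝕜 := ℂ) (φ n)
  have hbdd := isVonNBounded_image_ofSupportedIn hKX haB
  obtain ⟨q, hq, hpq⟩ := htop ((supSeminorm hbdd).comp (G.obj X).subtype)
    ((continuous_supSeminorm hbdd).comp continuous_subtype_val)
  obtain ⟨B, hBbdd, c, hc, hqB⟩ := exists_bounded_of_continuous_seminorm q hq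
  obtain ⟨L, hLX, A, hA, rfl⟩ := exists_isVonNBounded_supportedIn hBbdd
  -- Only now is `n` chosen, so that `X_n` contains the supports governing `q`; topologizability is
  -- then used for the single iterate `m n`.
  obtain ⟨n, hn⟩ := hXn.exists_subset L.isCompact hLX
  obtain ⟨γ, hγ, hγpq⟩ := hpq (m n) (hm n)
  obtain ⟨h, hhG, hhχ⟩ := hh n
  have hballX : ball (y n) (ε n) ≤ X := fun v hv => (hball n (Metric.ball_subset_closedBall hv)).1
  have hle : Xn n ⊔ ball (y n) (ε n) ≤ X :=
    sup_le (subset_closure.trans (hXn.closure_subset_self n)) hballX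
  have hdisj : Disjoint (Xn n : Set (Eucl d)) (ball (y n) (ε n) : Set (Eucl d)) :=
    disjoint_left.2 fun v hv hv' =>
      (hball n (Metric.ball_subset_closedBall hv')).2 (subset_closure hv)
  -- The constant combines the scaling of `φ n` in `p`, the factor `γ` for the iterate, and the
  -- factor `c` bounding `q`.
  obtain ⟨u, r, hr, hur, hlt⟩ := exists_not_le_of_denseRange hle hdisj
    (hdense n (y n) (hball n (Metric.mem_closedBall_self (hε n).le)) (ε n) (hε n)
      (Metric.closure_ball_subset_closedBall.trans
        ((hball n).trans (sdiff_subset_sdiff_right subset_closure))) hle)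
    hhG hhχ hn hA hLX ((a n)⁻¹ * (γ * c))
  have h1 : q u ≤ c * r := hqB u r hr (by rintro _ ⟨f, hf, rfl⟩; exact hur f hf)
  have h2 := le_supSeminorm hbdd
    ((restrictOp (ContinuousLinearMap.precomp ℂ T) (G.obj X) hG ^ m n) u).1
    (φ := (a n : ℂ) • TestFunction.ofSupportedIn hKX (φ n))
    ⟨(a n : ℂ) • φ n, mem_iUnion.2 ⟨n, φ n, rfl, rfl⟩, rfl⟩
  rw [restrictOp_precomp_pow_apply, map_smul, map_smul, hφ, norm_smul, Complex.norm_real,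
    Real.norm_of_nonneg (ha n).le] at h2
  have h3 := h2.trans ((hγpq u).trans (mul_le_mul_of_nonneg_left h1 hγ.le))
  rw [mul_assoc, inv_mul_lt_iff₀ (ha n), mul_assoc] at hlt
  exact hlt.not_ge h3

end

end DistSheaf

end

open DistSheaf in
theorem mainTheorem1 {d : ℕ} (X : Opens (Eucl d)) (w : Eucl d → ℂ) (hw : ContDiffOn ℝ ∞ w X)
    (ψ : Eucl d → Eucl d) (hψmaps : Set.MapsTo ψ X X) (hψ : ContDiffOn ℝ ∞ ψ X)
    (hψinj : Set.InjOn ψ X) (hψdet : ∀ x ∈ X, (fderiv ℝ ψ x).det ≠ 0) :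
    (∃! C : Distr X →L[ℂ] Distr X, IsWeightedCompositionOperator X w ψ C) ∧
    ∀ C : Distr X →L[ℂ] Distr X, IsWeightedCompositionOperator X w ψ C →
      ∀ (G : SheafOfDistributions d) (hG : ∀ u ∈ G.obj X, C u ∈ G.obj X),
        ConditionA G X → ConditionB G X → ConditionC X w ψ →
          (IsTopologizable (E := G.obj X) (restrictOp C (G.obj X) hG) ↔ HasStableOrbits X ψ) := by
  obtain ⟨T, hT⟩ := exists_transpose hw hψmaps hψ hψinj hψdet
  have hTC := hT.isWeightedCompositionOperator hw hψmaps hψ hψinj hψdet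
  have huniq (C : Distr X →L[ℂ] Distr X) (hC : IsWeightedCompositionOperator X w ψ C) :
      C = ContinuousLinearMap.precomp ℂ T :=
    ext_of_eq_on_ofFun fun f hf => (hC f hf.continuousOn).trans (hTC f hf.continuousOn).symm
  refine ⟨⟨_, hTC, huniq⟩, fun C hC G hG hcA hcB hcC => ?_⟩
  obtain rfl := huniq C hC
  exact ⟨hT.hasStableOrbits hw hψmaps hψ hψinj hψdet hG hcA hcB hcC, hT.isTopologizable _ hG⟩
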